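/- Let $F$ be a nonarchimedean local field, $E/F$ a separable quadratic extension with nontrivial automorphism $x\mapsto\bar x$, and let $J=\begin{pmatrix}0&1\\-1&0\end{pmatrix}$, $$H=\mathrm{U}(1,1)(F)=\{h\in \mathrm{GL}_2(E): hJ\,{}^t\bar h=J\},\qquad N=\Big\{n(x)=\begin{pmatrix}1&x\\0&1\end{pmatrix}: x\in F\Big\}\subset H .$$ Let $\psi$ be a nontrivial continuous (unitary) additive character of $F$, let $\kappa\in F^\times\setminus \mathrm{Nm}_{E/F}(E^\times)$, and put $\psi_\kappa(x)=\psi(\kappa x)$. For $h=\begin{pmatrix}a&b\\c&d\end{pmatrix}\in H$ let $h^\kappa=\mathrm{diag}(\kappa,1)\,h\,\mathrm{diag}(\kappa,1)^{-1}=\begin{pmatrix}a&\kappa b\\\kappa^{-1}c&d\end{pmatrix}\in H$, and for a representation $(\pi,V)$ of $H$ let $\pi^\kappa$ be the representation $\pi^\kappa(h)=\pi(h^\kappa)$ on $V$. For a nontrivial additive character $\psi'$ of $F$, let $\mathcal W(\pi,\psi')$ be the space of functions on $H$ spanned by the functions $h\mapsto\lambda(\pi(h)v)$, where $v\in V$ and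 $\lambda:V\to\mathbb C$ is a linear functional such that $\lambda(\pi(n(x))v)=\psi'(x)\lambda(v)$ for all $x\in F$, $v\in V$. Let $(\pi,V)$ be an irreducible smooth complex representation of $H$ such that $\mathcal W(\pi,\psi)\neq0$ and $\mathcal W(\pi,\psi_\kappa)\neq 0$. Then: 1. if $\pi$ is admissible, then $\pi\cong\pi^\kappa$; 2. for every $W\in\mathcal W(\pi,\psi)$ the function $W^\kappa(h)=W(h^\kappa)$ belongs to $\mathcal W(\pi,\psi_\kappa)$, and $W\mapsto W^\kappa$ is a bijection from $\mathcal W(\pi,\psi)$ onto $\mathcal W(\pi,\psi_\kappa)$. -/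

import Mathlib

open Matrix

/-- The matrix of the standard skew-Hermitian form on `E²`. -/
def skewJ (E : Type*) [Field E] : Matrix (Fin 2) (Fin 2) E := !![0, 1; -1, 0]

section UnitaryGroup

variable {F E : Type*} [Field F] [Field E] [Algebra F E]

/-- The unitary group `U(1,1)` of a quadratic extension `E / F` with conjugation `σ`:
all `g ∈ GL₂(E)` with `g J (ᵗ(σ g)) = J`. -/
def U11 (σ : E ≃ₐ[F] E) : Subgroup (GL (Fin 2) E) where
  carrier := {g | (g : Matrix (Fin 2) (Fin 2) E) * skewJ E
    * ((g : Matrix (Fin 2) (Fin 2) E).map σ)ᵀ = skewJ E}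
  one_mem' := by
    simp [Matrix.map_one]
  mul_mem' := by
    intro g h hg hh
    simp only [Set.mem_ofPred_eq, Units.val_mul] at hg hh ⊢
    have hm : ((g : Matrix (Fin 2) (Fin 2) E) * (h : Matrix (Fin 2) (Fin 2) E)).map σ
        = (g : Matrix (Fin 2) (Fin 2) E).map σ * (h : Matrix (Fin 2) (Fin 2) E).map σ :=
      Matrix.map_mul
    rw [hm, Matrix.transpose_mul]
    calc (g : Matrix (Fin 2) (Fin 2) E) * h * skewJ E
          * (((h : Matrix (Fin 2) (Fin 2) E).map σ)ᵀ * ((g : Matrix (Fin 2) (Fin 2) E).map σ)ᵀ)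
        = g * (h * skewJ E * ((h : Matrix (Fin 2) (Fin 2) E).map σ)ᵀ)
          * ((g : Matrix (Fin 2) (Fin 2) E).map σ)ᵀ := by simp only [Matrix.mul_assoc]
      _ = skewJ E := by rw [hh, hg]
  inv_mem' := by
    intro g hg
    simp only [Set.mem_ofPred_eq] at hg ⊢
    have h1 : ((g⁻¹ : GL (Fin 2) E) : Matrix (Fin 2) (Fin 2) E)
        * (g : Matrix (Fin 2) (Fin 2) E) = 1 := by
      rw [← Units.val_mul, inv_mul_cancel, Units.val_one]
    have h2 : ((g : Matrix (Fin 2) (Fin 2) E).map σ)ᵀ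
        * (((g⁻¹ : GL (Fin 2) E) : Matrix (Fin 2) (Fin 2) E).map σ)ᵀ = 1 := by
      rw [← Matrix.transpose_mul, ← Matrix.map_mul, h1]
      simp [Matrix.map_one]
    calc ((g⁻¹ : GL (Fin 2) E) : Matrix (Fin 2) (Fin 2) E) * skewJ E
          * (((g⁻¹ : GL (Fin 2) E) : Matrix (Fin 2) (Fin 2) E).map σ)ᵀ
        = ((g⁻¹ : GL (Fin 2) E) : Matrix (Fin 2) (Fin 2) E)
          * (g * skewJ E * ((g : Matrix (Fin 2) (Fin 2) E).map σ)ᵀ)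
          * (((g⁻¹ : GL (Fin 2) E) : Matrix (Fin 2) (Fin 2) E).map σ)ᵀ := by rw [hg]
      _ = (((g⁻¹ : GL (Fin 2) E) : Matrix (Fin 2) (Fin 2) E) * g) * skewJ E
          * (((g : Matrix (Fin 2) (Fin 2) E).map σ)ᵀ
            * (((g⁻¹ : GL (Fin 2) E) : Matrix (Fin 2) (Fin 2) E).map σ)ᵀ) := by
          simp only [Matrix.mul_assoc]
      _ = skewJ E := by rw [h1, h2, Matrix.one_mul, Matrix.mul_one]

theorem mem_U11 (σ : E ≃ₐ[F] E) (g : GL (Fin 2) E) :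
    g ∈ U11 σ ↔ (g : Matrix (Fin 2) (Fin 2) E) * skewJ E
      * ((g : Matrix (Fin 2) (Fin 2) E).map σ)ᵀ = skewJ E := Iff.rfl

/-- The upper triangular unipotent element `n(x) = (1 x; 0 1)` of `U(1,1)`, for `x ∈ F`. -/
def unipotent (σ : E ≃ₐ[F] E) (x : F) : U11 σ :=
  ⟨⟨!![1, algebraMap F E x; 0, 1], !![1, -algebraMap F E x; 0, 1],
      by ext i j; fin_cases i <;> fin_cases j <;> simp [Matrix.mul_apply, Fin.sum_univ_two],
      by ext i j; fin_cases i <;> fin_cases j <;> simp [Matrix.mul_apply, Fin.sum_univ_two]⟩, by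
    rw [mem_U11]
    ext i j
    fin_cases i <;> fin_cases j <;>
      simp [skewJ, Matrix.mul_apply, Fin.sum_univ_two, Algebra.algebraMap_eq_smul_one]⟩

/-- The element `α(κ) = diag(κ, 1)` of `GL₂(F) ⊆ GL₂(E)`. -/
def alphaKappa (E : Type*) [Field E] [Algebra F E] (κ : Fˣ) : GL (Fin 2) E :=
  ⟨!![algebraMap F E κ, 0; 0, 1], !![algebraMap F E (κ⁻¹ : Fˣ), 0; 0, 1],
    by ext i j; fin_cases i <;> fin_cases j <;>
        simp [Matrix.mul_apply, Fin.sum_univ_two],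
    by ext i j; fin_cases i <;> fin_cases j <;>
        simp [Matrix.mul_apply, Fin.sum_univ_two]⟩

theorem alphaKappa_conj_mem (σ : E ≃ₐ[F] E) (κ : Fˣ) (h : U11 σ) :
    alphaKappa E κ * h * (alphaKappa E κ)⁻¹ ∈ U11 σ := by
  have hh := (mem_U11 σ _).1 h.2
  have hmap : ∀ x : Fˣ, (!![algebraMap F E x, 0; 0, 1]).map σ = !![algebraMap F E x, 0; 0, 1] := by
    intro x
    ext i j
    fin_cases i <;> fin_cases j <;> simp
  have e1 : ((alphaKappa E κ : GL (Fin 2) E) : Matrix (Fin 2) (Fin 2) E)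
      = !![algebraMap F E κ, 0; 0, 1] := rfl
  have e2 : (((alphaKappa E κ)⁻¹ : GL (Fin 2) E) : Matrix (Fin 2) (Fin 2) E)
      = !![algebraMap F E (κ⁻¹ : Fˣ), 0; 0, 1] := rfl
  have hinv : algebraMap F E (κ⁻¹ : Fˣ) * algebraMap F E κ = 1 := by
    rw [← map_mul, Units.inv_mul, map_one]
  rw [mem_U11]
  simp only [Units.val_mul, e1, e2, Matrix.map_mul, hmap, Matrix.transpose_mul]
  have a1 : !![algebraMap F E (κ⁻¹ : Fˣ), 0; 0, 1] * skewJ E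
      * (!![algebraMap F E (κ⁻¹ : Fˣ), 0; 0, 1])ᵀ
      = algebraMap F E (κ⁻¹ : Fˣ) • skewJ E := by
    ext i j
    fin_cases i <;> fin_cases j <;> simp [skewJ, Matrix.mul_apply, Fin.sum_univ_two]
  have a2 : !![algebraMap F E κ, 0; 0, 1] * skewJ E * (!![algebraMap F E κ, 0; 0, 1])ᵀ
      = algebraMap F E κ • skewJ E := by
    ext i j
    fin_cases i <;> fin_cases j <;> simp [skewJ, Matrix.mul_apply, Fin.sum_univ_two, Algebra.algebraMap_eq_smul_one]
  generalize (!![algebraMap F E κ, 0; 0, 1] : Matrix (Fin 2) (Fin 2) E) = A at *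
  generalize (!![algebraMap F E (κ⁻¹ : Fˣ), 0; 0, 1] : Matrix (Fin 2) (Fin 2) E) = B at *
  generalize ((h : GL (Fin 2) E) : Matrix (Fin 2) (Fin 2) E) = g at *
  calc A * g * B * skewJ E * (Bᵀ * ((g.map σ)ᵀ * Aᵀ))
      = A * (g * (B * skewJ E * Bᵀ) * (g.map σ)ᵀ) * Aᵀ := by simp only [Matrix.mul_assoc]
    _ = algebraMap F E (κ⁻¹ : Fˣ) • (A * (g * skewJ E * (g.map σ)ᵀ) * Aᵀ) := by
        rw [a1]; simp only [Matrix.mul_smul, Matrix.smul_mul]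
    _ = skewJ E := by rw [hh, a2, smul_smul, hinv, one_smul]

/-- The automorphism `h ↦ h^κ = α(κ) h α(κ)⁻¹` of `U(1,1)`. -/
def kappaConj (σ : E ≃ₐ[F] E) (κ : Fˣ) : U11 σ →* U11 σ where
  toFun h := ⟨alphaKappa E κ * h * (alphaKappa E κ)⁻¹, alphaKappa_conj_mem σ κ h⟩
  map_one' := by ext1; simp
  map_mul' g h := by ext1; simp [mul_assoc]

end UnitaryGroup

section Representations

/-- A complex representation of a topological group is smooth if every vector has an open
stabilizer. -/
def IsSmoothRep {G V : Type*} [Group G] [TopologicalSpace G] [AddCommGroup V] [Module ℂ V]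
    (π : Representation ℂ G V) : Prop :=
  ∀ v : V, IsOpen {g : G | π g v = v}

/-- A representation is admissible if it is smooth and every open subgroup has a
finite-dimensional space of fixed vectors. -/
def IsAdmissibleRep {G V : Type*} [Group G] [TopologicalSpace G] [AddCommGroup V] [Module ℂ V]
    (π : Representation ℂ G V) : Prop :=
  IsSmoothRep π ∧ ∀ K : Subgroup G, IsOpen (K : Set G) →
    FiniteDimensional ℂ (Representation.invariants (MonoidHom.comp π K.subtype))

variable {F E V : Type*} [Field F] [Field E] [Algebra F E] [AddCommGroup V] [Module ℂ V]

/-- The representation `π^κ` on the same space: `π^κ(h) = π(h^κ)`. -/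
def kappaTwist (σ : E ≃ₐ[F] E) (κ : Fˣ) (π : Representation ℂ (U11 σ) V) :
    Representation ℂ (U11 σ) V :=
  MonoidHom.comp π (kappaConj σ κ)

/-- The space `Hom_N(π, ψ)` of `ψ`-Whittaker functionals. -/
def whittakerFunctionals (σ : E ≃ₐ[F] E) (π : Representation ℂ (U11 σ) V)
    (ψ : AddChar F Circle) : Submodule ℂ (Module.Dual ℂ V) where
  carrier := {l | ∀ (x : F) (v : V), l (π (unipotent σ x) v) = (ψ x : ℂ) * l v}
  zero_mem' := by intro x v; simp
  add_mem' := by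
    intro l m hl hm x v
    simp only [LinearMap.add_apply, hl x v, hm x v, mul_add]
  smul_mem' := by
    intro c l hl x v
    simp only [LinearMap.smul_apply, hl x v, smul_eq_mul]
    ring

/-- The Whittaker space `W(π, ψ)`: the space of functions on `U(1,1)` spanned by the
`h ↦ l (π(h) v)` with `l` a `ψ`-Whittaker functional and `v ∈ V`. -/
def whittakerSpace (σ : E ≃ₐ[F] E) (π : Representation ℂ (U11 σ) V)
    (ψ : AddChar F Circle) : Submodule ℂ (U11 σ → ℂ) :=
  Submodule.span ℂ {W | ∃ l ∈ whittakerFunctionals σ π ψ, ∃ v : V, W = fun h => l (π h v)}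

end Representations

/-! Everything reduces to π ≅ π^κ. Such an isomorphism exchanges ψ-Whittaker and ψ_κ-Whittaker
functionals by composition, so W ↦ W^κ matches the two Whittaker spaces (`bijOn_whittakerSpace`).

The isomorphism comes from a Gelfand–Kazhdan argument run with a compact group in place of N, so
neither distributions nor admissibility enter. Let δ generate the conductor of ψ, with v δ < 1, and
let K = `gammaOne`. Then k ↦ ψ(k₀₁) is a character of K; let e and e' be the projections onto its
eigenspaces in π and in π' = π^{κ⁻¹}. Formally e' π(h) e plays the role of e α(κ)h e in a group
containing α(κ). The heart is `HasConductor.flipCompatible`: for M in GL₂(F), either KMK supports no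
function equivariant under this character on both sides, or the flip of M lies in KMK with
cancelling characters. Elements of α(κ)U(1,1) are scalars times matrices over F, so for an
eigenvector u the vector e' π(x) u does not change when α(κ)x is flipped (`invariantsProj_flip_eq`).
As the flip reverses products, e' π(h) e π(g) u = e' π'(g) e' π(h) u (`invariantsProj_commute`). For
suitable h this is a nonzero matrix coefficient shared by π and π', and irreducibility gives π ≅ π'.

Nonzero eigenvectors come from the Whittaker functionals. If l(w) ≠ 0, a twist by α(t)⁻¹ with t
small makes the lower triangular part of K fix w, while l transforms by the character under the
unipotent upper part; hence l(e w) = l(w) ≠ 0. -/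

/-! ### The anti-involution of two by two matrices. -/

section Flip

variable {R S : Type*}

/-- The anti-involution `(a b; c d) ↦ (d b; c a)` of the ring of two by two matrices. -/
def flipMatrix (M : Matrix (Fin 2) (Fin 2) R) : Matrix (Fin 2) (Fin 2) R :=
  !![M 1 1, M 0 1; M 1 0, M 0 0]

theorem flipMatrix_mul [CommRing R] (A B : Matrix (Fin 2) (Fin 2) R) :
    flipMatrix (A * B) = flipMatrix B * flipMatrix A := by
  ext i j
  fin_cases i <;> fin_cases j <;>
    simp [flipMatrix, Matrix.mul_apply, Fin.sum_univ_two] <;> ring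

theorem flipMatrix_flipMatrix (A : Matrix (Fin 2) (Fin 2) R) :
    flipMatrix (flipMatrix A) = A := by
  ext i j
  fin_cases i <;> fin_cases j <;> simp [flipMatrix]

theorem flipMatrix_smul [CommRing R] (c : R) (A : Matrix (Fin 2) (Fin 2) R) :
    flipMatrix (c • A) = c • flipMatrix A := by
  ext i j
  fin_cases i <;> fin_cases j <;> simp [flipMatrix]

theorem flipMatrix_map (f : R → S) (A : Matrix (Fin 2) (Fin 2) R) :
    flipMatrix (A.map f) = (flipMatrix A).map f := by
  ext i j
  fin_cases i <;> fin_cases j <;> simp [flipMatrix]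

theorem det_flipMatrix [CommRing R] (A : Matrix (Fin 2) (Fin 2) R) : (flipMatrix A).det = A.det := by
  simp [flipMatrix, Matrix.det_fin_two]; ring

/-- The anti-involution `flipMatrix` on the special linear group. -/
def flipSL [CommRing R] (g : SpecialLinearGroup (Fin 2) R) : SpecialLinearGroup (Fin 2) R :=
  ⟨flipMatrix g.1, by rw [det_flipMatrix]; exact g.2⟩

theorem coe_flipSL [CommRing R] (g : SpecialLinearGroup (Fin 2) R) :
    (flipSL g : Matrix (Fin 2) (Fin 2) R) = flipMatrix g.1 := rfl

theorem flipSL_mul [CommRing R] (g h : SpecialLinearGroup (Fin 2) R) :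
    flipSL (g * h) = flipSL h * flipSL g :=
  Subtype.ext (flipMatrix_mul _ _)

theorem flipSL_flipSL [CommRing R] (g : SpecialLinearGroup (Fin 2) R) : flipSL (flipSL g) = g :=
  Subtype.ext (flipMatrix_flipMatrix _)

end Flip

/-! ### Double cosets of the congruence subgroup and the flip. -/

section Congruence

variable {F Γ₀ : Type*} [Field F] [LinearOrderedCommGroupWithZero Γ₀]

/-- The congruence subgroup of `SL₂` of matrices `(a b; c d)` with `b` integral and
`a - 1`, `c`, `d - 1` of valuation at most that of `δ`. -/
def gammaOne (v : Valuation F Γ₀) (δ : F) (hδ : v δ < 1) :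
    Subgroup (SpecialLinearGroup (Fin 2) F) where
  carrier := {g | v (g.1 0 0 - 1) ≤ v δ ∧ v (g.1 0 1) ≤ 1 ∧ v (g.1 1 0) ≤ v δ ∧
    v (g.1 1 1 - 1) ≤ v δ}
  one_mem' := by simp
  mul_mem' := by
    rintro g h ⟨g1, g2, g3, g4⟩ ⟨h1, h2, h3, h4⟩
    have one : ∀ x, v (x - 1) ≤ v δ → v x ≤ 1 := fun x hx => by
      have := v.map_add_le (hx.trans hδ.le) (v.map_one.le)
      simpa using this
    have g5 := one _ g1
    have h5 := one _ h1
    have g6 := one _ g4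
    have h6 := one _ h4
    simp only [Set.mem_ofPred_eq, Matrix.SpecialLinearGroup.coe_mul, Matrix.mul_apply, Fin.sum_univ_two]
    refine ⟨?_, ?_, ?_, ?_⟩
    · have : g.1 0 0 * h.1 0 0 + g.1 0 1 * h.1 1 0 - 1
          = g.1 0 0 * (h.1 0 0 - 1) + (g.1 0 0 - 1) + g.1 0 1 * h.1 1 0 := by ring
      rw [this]
      refine v.map_add_le (v.map_add_le ?_ g1) ?_ <;> rw [map_mul]
      · exact mul_le_of_le_one_of_le g5 h1
      · exact mul_le_of_le_one_of_le g2 h3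
    · refine v.map_add_le ?_ ?_ <;> rw [map_mul]
      · exact mul_le_one' g5 h2
      · exact mul_le_one' g2 h6
    · refine v.map_add_le ?_ ?_ <;> rw [map_mul]
      · exact mul_le_of_le_of_le_one g3 h5
      · exact mul_le_of_le_one_of_le g6 h3
    · have : g.1 1 0 * h.1 0 1 + g.1 1 1 * h.1 1 1 - 1
          = g.1 1 1 * (h.1 1 1 - 1) + (g.1 1 1 - 1) + g.1 1 0 * h.1 0 1 := by ring
      rw [this]
      refine v.map_add_le (v.map_add_le ?_ g4) ?_ <;> rw [map_mul]
      · exact mul_le_of_le_one_of_le g6 h4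
      · exact mul_le_of_le_of_le_one g3 h2
  inv_mem' := by
    rintro g ⟨g1, g2, g3, g4⟩
    simp only [Set.mem_ofPred_eq, Matrix.SpecialLinearGroup.coe_inv, Matrix.adjugate_fin_two]
    simpa using ⟨g4, g2, g3, g1⟩

theorem mem_gammaOne {v : Valuation F Γ₀} {δ : F} {hδ : v δ < 1}
    {g : SpecialLinearGroup (Fin 2) F} :
    g ∈ gammaOne v δ hδ ↔ v (g.1 0 0 - 1) ≤ v δ ∧ v (g.1 0 1) ≤ 1 ∧ v (g.1 1 0) ≤ v δ ∧
      v (g.1 1 1 - 1) ≤ v δ := Iff.rfl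

theorem mk_mem_gammaOne {v : Valuation F Γ₀} {δ : F} {hδ : v δ < 1} {a b c d : F}
    (h : (!![a, b; c, d] : Matrix (Fin 2) (Fin 2) F).det = 1) (ha : v (a - 1) ≤ v δ)
    (hb : v b ≤ 1) (hc : v c ≤ v δ) (hd : v (d - 1) ≤ v δ) :
    (⟨!![a, b; c, d], h⟩ : SpecialLinearGroup (Fin 2) F) ∈ gammaOne v δ hδ :=
  ⟨ha, hb, hc, hd⟩

theorem flipSL_mem_gammaOne {v : Valuation F Γ₀} {δ : F} {hδ : v δ < 1}
    {g : SpecialLinearGroup (Fin 2) F} (hg : g ∈ gammaOne v δ hδ) :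
    flipSL g ∈ gammaOne v δ hδ := by
  obtain ⟨g1, g2, g3, g4⟩ := mem_gammaOne.1 hg
  exact mem_gammaOne.2 ⟨by simpa [coe_flipSL, flipMatrix] using g4,
    by simpa [coe_flipSL, flipMatrix] using g2, by simpa [coe_flipSL, flipMatrix] using g3,
    by simpa [coe_flipSL, flipMatrix] using g1⟩

/-- For a subgroup `K` of `SL₂` with the character `k ↦ ψ (k₀₁)`: either the double coset of `M`
supports no equivariant function, or `flipMatrix M` lies in it, with trivial character. -/
def FlipCompatible (K : Subgroup (SpecialLinearGroup (Fin 2) F)) (ψ : AddChar F Circle)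
    (M : Matrix (Fin 2) (Fin 2) F) : Prop :=
  (∃ k ∈ K, ∃ k' ∈ K, M * k.1 = k'.1 * M ∧ ψ (k.1 0 1) ≠ ψ (k'.1 0 1)) ∨
    ∃ k₁ ∈ K, ∃ k₂ ∈ K, flipMatrix M = k₁.1 * M * k₂.1 ∧ ψ (k₁.1 0 1) * ψ (k₂.1 0 1) = 1

theorem FlipCompatible.smul {K : Subgroup (SpecialLinearGroup (Fin 2) F)} {ψ : AddChar F Circle}
    {M : Matrix (Fin 2) (Fin 2) F} (h : FlipCompatible K ψ M) (c : F) :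
    FlipCompatible K ψ (c • M) := by
  rcases h with ⟨k, hk, k', hk', h, hψ⟩ | ⟨k₁, h₁, k₂, h₂, h, hψ⟩
  · exact Or.inl ⟨k, hk, k', hk', by rw [Matrix.smul_mul, Matrix.mul_smul, h], hψ⟩
  · exact Or.inr ⟨k₁, h₁, k₂, h₂, by rw [flipMatrix_smul, Matrix.mul_smul, Matrix.smul_mul, h], hψ⟩

variable {v : Valuation F Γ₀} {δ : F} {hδ : v δ < 1} {ψ : AddChar F Circle}

theorem FlipCompatible.flip {M : Matrix (Fin 2) (Fin 2) F}
    (h : FlipCompatible (gammaOne v δ hδ) ψ (flipMatrix M)) :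
    FlipCompatible (gammaOne v δ hδ) ψ M := by
  rcases h with ⟨k, hk, k', hk', h, hψ⟩ | ⟨k₁, h₁, k₂, h₂, h, hψ⟩
  · refine Or.inl ⟨flipSL k', flipSL_mem_gammaOne hk', flipSL k, flipSL_mem_gammaOne hk, ?_, ?_⟩
    · have := congrArg flipMatrix h
      simp only [flipMatrix_mul, flipMatrix_flipMatrix] at this
      exact this.symm
    · simpa [coe_flipSL, flipMatrix] using hψ.symm
  · refine Or.inr ⟨k₁⁻¹, inv_mem h₁, k₂⁻¹, inv_mem h₂, ?_, ?_⟩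
    · rw [flipMatrix_flipMatrix] at h
      have e1 : (k₁⁻¹).1 * k₁.1 = 1 := by
        have := congrArg Subtype.val (inv_mul_cancel k₁); exact this
      have e2 : k₂.1 * (k₂⁻¹).1 = 1 := by
        have := congrArg Subtype.val (mul_inv_cancel k₂); exact this
      conv_rhs => rw [h]
      calc flipMatrix M = (k₁⁻¹).1 * k₁.1 * flipMatrix M * (k₂.1 * (k₂⁻¹).1) := by
            rw [e1, e2, one_mul, mul_one]
        _ = _ := by simp only [Matrix.mul_assoc]
    · have e : ∀ k : SpecialLinearGroup (Fin 2) F, (k⁻¹).1 0 1 = - k.1 0 1 := fun k => by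
        simp [Matrix.SpecialLinearGroup.coe_inv, Matrix.adjugate_fin_two]
      rw [e, e, AddChar.map_neg_eq_inv, AddChar.map_neg_eq_inv, ← mul_inv, hψ, inv_one]

/-- `ψ` is trivial on the ideal generated by `δ`, and on no larger fractional ideal. -/
structure HasConductor (v : Valuation F Γ₀) (ψ : AddChar F Circle) (δ : F) : Prop where
  ne_zero : δ ≠ 0
  eq_one : ∀ x, v x ≤ v δ → ψ x = 1
  exists_ne_one : ∀ x, v δ < v x → ∃ y, v y ≤ 1 ∧ ψ (x * y) ≠ 1

theorem HasConductor.eq_of_le (hψ : HasConductor v ψ δ) {x y : F} (h : v (x - y) ≤ v δ) :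
    ψ x = ψ y := by
  have := hψ.eq_one _ h
  rwa [AddChar.map_sub_eq_div, div_eq_one] at this

/-- Conjugating the upper unipotent with entry tyD by M stays in K under the side conditions, and
the two characters differ by ψ(t(D - 1)y). If t(D - 1) were outside the conductor, some integral y
would violate `hrel`. The free scale t lets each application extract the strongest bound. -/
theorem HasConductor.le_of_upper (hψ : HasConductor v ψ δ) {M : Matrix (Fin 2) (Fin 2) F}
    (hM : M 0 0 = 1)
    (hrel : ∀ k ∈ gammaOne v δ hδ, ∀ k' ∈ gammaOne v δ hδ, M * k.1 = k'.1 * M →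
      ψ (k.1 0 1) = ψ (k'.1 0 1)) (hc : v (M 1 0) < 1) {t : F}
    (h1 : v (t * M.det) ≤ 1) (h2 : v t ≤ 1) (h3 : v (t * M 1 0) ≤ v δ) :
    v (t * (M.det - 1)) ≤ v δ := by
  by_contra! hlt
  obtain ⟨y, hy, hne⟩ := hψ.exists_ne_one _ hlt
  set D := M.det with hDdef
  set c := M 1 0 with hcdef
  have hdet : M 1 1 = D + M 0 1 * c := by
    rw [hDdef, Matrix.det_fin_two, hM]; ring
  have hk := hrel ⟨!![1, t * y * D; 0, 1], by simp [Matrix.det_fin_two]⟩ ?_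
    ⟨!![1 - t * y * c, t * y; - (t * y * c ^ 2), 1 + t * y * c], by
      simp [Matrix.det_fin_two]; ring⟩ ?_ ?_
  · apply hne
    simp only [Matrix.of_apply, Matrix.cons_val', Matrix.cons_val_zero, Matrix.cons_val_one] at hk
    have e : t * (D - 1) * y = t * y * D - t * y := by ring
    rw [e, AddChar.map_sub_eq_div, div_eq_one]
    simpa using hk
  · refine mk_mem_gammaOne _ (by simp) ?_ (by simp) (by simp)
    have : v (t * D * y) ≤ 1 := by rw [map_mul]; exact mul_le_one' h1 hy
    simpa [mul_right_comm] using this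
  · have h5 : v (t * y * c) ≤ v δ := by
      rw [mul_right_comm, map_mul]; exact mul_le_of_le_of_le_one h3 hy
    have h6 : v (t * y) ≤ 1 := by rw [map_mul]; exact mul_le_one' h2 hy
    have h7 : v (t * y * c ^ 2) ≤ v δ := by
      rw [pow_two, ← mul_assoc, map_mul]; exact mul_le_of_le_of_le_one h5 hc.le
    refine mk_mem_gammaOne _ ?_ ?_ ?_ ?_
    · rw [sub_sub_cancel_left, Valuation.map_neg]; exact h5
    · exact h6
    · rw [Valuation.map_neg]; exact h7
    · rw [add_sub_cancel_left]; exact h5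
  · ext i j
    fin_cases i <;> fin_cases j <;> simp [Matrix.mul_apply, Fin.sum_univ_two, hM, hdet, ← hcdef] <;>
      ring

/-- The same with a lower unipotent, whose character is trivial, while that of its conjugate by M is
ψ(tyb²). -/
theorem HasConductor.le_of_lower (hψ : HasConductor v ψ δ) {M : Matrix (Fin 2) (Fin 2) F}
    (hM : M 0 0 = 1) (hD : v M.det = 1)
    (hrel : ∀ k ∈ gammaOne v δ hδ, ∀ k' ∈ gammaOne v δ hδ, M * k.1 = k'.1 * M →
      ψ (k.1 0 1) = ψ (k'.1 0 1)) (hd : v (M 1 1) ≤ 1) {t : F}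
    (h1 : v t ≤ v δ) (h2 : v (t * M 0 1 ^ 2) ≤ 1) (h3 : v (t * M 0 1) ≤ v δ) :
    v (t * M 0 1 ^ 2) ≤ v δ := by
  by_contra! hlt
  obtain ⟨y, hy, hne⟩ := hψ.exists_ne_one _ hlt
  set D := M.det with hDdef
  set b := M 0 1 with hbdef
  set d := M 1 1 with hddef
  have hdet : M 1 0 * b = d - D := by
    rw [hDdef, Matrix.det_fin_two, hM]; ring
  have hk := hrel ⟨!![1, 0; - (t * y * D), 1], by simp [Matrix.det_fin_two]⟩ ?_
    ⟨!![1 - t * y * b * d, t * y * b ^ 2; - (t * y * d ^ 2), 1 + t * y * b * d], by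
      simp [Matrix.det_fin_two]; ring⟩ ?_ ?_
  · apply hne
    simp only [Matrix.of_apply, Matrix.cons_val', Matrix.cons_val_zero, Matrix.cons_val_one] at hk
    rw [mul_right_comm]
    simpa using hk.symm
  · refine mk_mem_gammaOne _ (by simp) (by simp) ?_ (by simp)
    simpa [hD] using mul_le_of_le_of_le_one h1 hy
  · have h5 : v (t * y * b * d) ≤ v δ := by
      have : t * y * b * d = t * b * (y * d) := by ring
      rw [this, map_mul, map_mul v y d]
      exact mul_le_of_le_of_le_one h3 (mul_le_one' hy hd)
    have h6 : v (t * y * b ^ 2) ≤ 1 := by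
      rw [mul_right_comm, map_mul]; exact mul_le_one' h2 hy
    have h7 : v (t * y * d ^ 2) ≤ v δ := by
      rw [mul_assoc, map_mul, map_mul, map_pow]
      exact mul_le_of_le_of_le_one h1 (mul_le_one' hy (pow_le_one' hd 2))
    refine mk_mem_gammaOne _ ?_ ?_ ?_ ?_
    · rw [sub_sub_cancel_left, Valuation.map_neg]; exact h5
    · exact h6
    · rw [Valuation.map_neg]; exact h7
    · rw [add_sub_cancel_left]; exact h5
  · ext i j
    fin_cases i <;> fin_cases j <;>
      simp [Matrix.mul_apply, Fin.sum_univ_two, hM, ← hbdef, ← hddef]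
    · linear_combination -(t * y * b) * hdet
    · ring
    · linear_combination -(t * y * d) * hdet
    · ring

/-- For z = (a - d)/c integral, n(-z) M n(z) is the flip of M, and the characters ψ(-z), ψ(z)
cancel. -/
theorem HasConductor.flipCompatible_of_sub_le (M : Matrix (Fin 2) (Fin 2) F)
    (h : v (M 0 0 - M 1 1) ≤ v (M 1 0)) : FlipCompatible (gammaOne v δ hδ) ψ M := by
  -- For c = 0 the hypothesis forces a = d, and division by zero gives the right value z = 0.
  set z := (M 0 0 - M 1 1) / M 1 0 with hz
  have hzc : z * M 1 0 = M 0 0 - M 1 1 := by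
    rcases eq_or_ne (M 1 0) 0 with h0 | h0
    · rw [h0, map_zero, le_zero_iff, map_eq_zero] at h
      rw [h0, h, mul_zero]
    · rw [hz, div_mul_cancel₀ _ h0]
  have hv : v z ≤ 1 := by
    rw [hz, map_div₀]
    exact div_le_one_of_le₀ h zero_le
  refine Or.inr ⟨⟨!![1, -z; 0, 1], by simp [Matrix.det_fin_two]⟩, ?_,
    ⟨!![1, z; 0, 1], by simp [Matrix.det_fin_two]⟩, ?_, ?_, ?_⟩
  · exact mk_mem_gammaOne _ (by simp) (by simpa using hv) (by simp) (by simp)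
  · exact mk_mem_gammaOne _ (by simp) (by simpa using hv) (by simp) (by simp)
  · ext i j
    fin_cases i <;> fin_cases j <;>
      simp [flipMatrix, Matrix.mul_apply, Matrix.vecMul, dotProduct, Fin.sum_univ_two]
    · linear_combination hzc
    · linear_combination z * hzc
    · linear_combination -hzc
  · simp [AddChar.map_neg_eq_inv]

/-- Outside the conjugation case c is a non-unit. If nothing obstructs equivariance, then D is a
unit, b is integral, and c and D - 1 lie in the ideal of δ; so M is upper unipotent modulo δ, and it
differs from its flip by an element of K. -/
theorem HasConductor.flipCompatible_of_zero_zero_eq_one (hψ : HasConductor v ψ δ)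
    {M : Matrix (Fin 2) (Fin 2) F} (hM : M 0 0 = 1) (hD : M.det ≠ 0)
    (hd : v (M 1 1) ≤ 1) : FlipCompatible (gammaOne v δ hδ) ψ M := by
  by_cases hle : v (M 0 0 - M 1 1) ≤ v (M 1 0)
  · exact HasConductor.flipCompatible_of_sub_le M hle
  by_cases hrel : ∃ k ∈ gammaOne v δ hδ, ∃ k' ∈ gammaOne v δ hδ, M * k.1 = k'.1 * M ∧
      ψ (k.1 0 1) ≠ ψ (k'.1 0 1)
  · exact Or.inl hrel
  push Not at hle hrel
  have hδ0 : v δ ≠ 0 := (Valuation.ne_zero_iff v).2 hψ.ne_zero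
  have hc : v (M 1 0) < 1 := by
    refine hle.trans_le (v.map_sub_le ?_ hd)
    rw [hM, map_one]
  have up := fun t => hψ.le_of_upper hM hrel hc (t := t)
  have hDv : v M.det ≠ 0 := (Valuation.ne_zero_iff v).2 hD
  -- If D is not a unit, take t as large as the side conditions allow: t = 1 or D⁻¹ when c is small
  -- enough, t = δ/c otherwise.
  have hD1 : v M.det = 1 := by
    rcases lt_trichotomy (v M.det) 1 with h | h | h
    · exfalso
      have hs : v (M.det - 1) = 1 := by
        rw [Valuation.map_sub_eq_of_lt_right _ (by simpa using h), map_one]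
      by_cases hcδ : v (M 1 0) ≤ v δ
      · have := up 1 (by simpa using h.le) (by simp) (by simpa using hcδ)
        rw [one_mul, hs] at this
        exact this.not_gt hδ
      · push Not at hcδ
        have hc0 : v (M 1 0) ≠ 0 := (zero_le.trans_lt hcδ).ne'
        have hq : v (δ / M 1 0) ≤ 1 := by
          rw [map_div₀]; exact div_le_one_of_le₀ hcδ.le zero_le
        have := up (δ / M 1 0) (by rw [map_mul]; exact mul_le_one' hq h.le) hq
          (by rw [div_mul_cancel₀ _ ((Valuation.ne_zero_iff v).1 hc0)])
        rw [map_mul, hs, mul_one, map_div₀, div_le_iff₀ (zero_lt_iff.2 hc0)] at this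
        exact this.not_gt (mul_lt_of_lt_one_right (zero_lt_iff.2 hδ0) hc)
    · exact h
    · exfalso
      have hs : v (M.det - 1) = v M.det := by
        rw [Valuation.map_sub_eq_of_lt_left _ (by simpa using h)]
      by_cases hcδ : v (M 1 0) ≤ v δ * v M.det
      · have := up (M.det)⁻¹ (by rw [inv_mul_cancel₀ hD, map_one])
          (by rw [map_inv₀]; exact inv_le_one_of_one_le₀ h.le)
          (by rw [map_mul, map_inv₀, inv_mul_le_iff₀ (zero_lt_iff.2 hDv), mul_comm]; exact hcδ)
        rw [map_mul, hs, map_inv₀, inv_mul_cancel₀ hDv] at this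
        exact this.not_gt hδ
      · push Not at hcδ
        have hc0 : v (M 1 0) ≠ 0 := (zero_le.trans_lt hcδ).ne'
        have hq : v (δ / M 1 0 * M.det) ≤ 1 := by
          rw [map_mul, map_div₀, div_mul_eq_mul_div]; exact div_le_one_of_le₀ hcδ.le zero_le
        have hq' : v (δ / M 1 0) ≤ 1 := by
          refine le_trans ?_ hq
          rw [map_mul]
          exact le_mul_of_one_le_right zero_le h.le
        have := up (δ / M 1 0) hq hq'
          (by rw [div_mul_cancel₀ _ ((Valuation.ne_zero_iff v).1 hc0)])
        rw [map_mul, hs, map_div₀, div_mul_eq_mul_div, div_le_iff₀ (zero_lt_iff.2 hc0)] at this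
        exact (le_of_mul_le_mul_left this (zero_lt_iff.2 hδ0)).not_gt (hc.trans h)
  -- If b is not integral, t = δ/b or t = b⁻² contradicts the lower bound, according to whether δb
  -- is integral.
  have hb : v (M 0 1) ≤ 1 := by
    by_contra! hb
    have hb0 : v (M 0 1) ≠ 0 := (zero_lt_one.trans hb).ne'
    have hb0' : M 0 1 ≠ 0 := (Valuation.ne_zero_iff v).1 hb0
    have low := fun t => hψ.le_of_lower hM hD1 hrel hd (t := t)
    by_cases hδb : v (δ * M 0 1) ≤ 1
    · have h1 : v (δ / M 0 1) ≤ v δ := by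
        rw [map_div₀, div_le_iff₀ (zero_lt_iff.2 hb0)]
        exact le_mul_of_one_le_right zero_le hb.le
      have e : δ / M 0 1 * M 0 1 ^ 2 = δ * M 0 1 := by field_simp
      have := low (δ / M 0 1) h1 (by rw [e]; exact hδb) (by rw [div_mul_cancel₀ _ hb0'])
      rw [e, map_mul] at this
      exact this.not_gt (lt_mul_of_one_lt_right (zero_lt_iff.2 hδ0) hb)
    · push Not at hδb
      rw [map_mul] at hδb
      have h1 : v ((M 0 1)⁻¹) ≤ v δ := by
        rw [map_inv₀, inv_le_iff_one_le_mul₀ (zero_lt_iff.2 hb0)]; exact hδb.le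
      have e : (M 0 1)⁻¹ ^ 2 * M 0 1 ^ 2 = 1 := by field_simp
      have e' : (M 0 1)⁻¹ ^ 2 * M 0 1 = (M 0 1)⁻¹ := by field_simp
      have := low ((M 0 1)⁻¹ ^ 2) (by
        rw [pow_two, map_mul]
        exact mul_le_of_le_one_of_le (h1.trans hδ.le) h1) (by rw [e, map_one])
        (by rw [e']; exact h1)
      rw [e, map_one] at this
      exact this.not_gt hδ
  have hdet : M.det = M 1 1 - M 0 1 * M 1 0 := by rw [Matrix.det_fin_two, hM, one_mul]
  -- Otherwise t = δ/c gives v(D - 1) ≤ v(c), hence v(a - d) ≤ v(c), which is the excluded case.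
  have hcδ : v (M 1 0) ≤ v δ := by
    by_contra! hcδ
    have hc0 : v (M 1 0) ≠ 0 := (zero_le.trans_lt hcδ).ne'
    have hq : v (δ / M 1 0) ≤ 1 := by
      rw [map_div₀]; exact div_le_one_of_le₀ hcδ.le zero_le
    have := up (δ / M 1 0) (by rw [map_mul, hD1, mul_one]; exact hq) hq
      (by rw [div_mul_cancel₀ _ ((Valuation.ne_zero_iff v).1 hc0)])
    rw [map_mul, map_div₀, div_mul_eq_mul_div, div_le_iff₀ (zero_lt_iff.2 hc0)] at this
    have h2 := le_of_mul_le_mul_left this (zero_lt_iff.2 hδ0)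
    refine hle.not_ge ?_
    have e : M 0 0 - M 1 1 = -(M.det - 1) - M 0 1 * M 1 0 := by rw [hdet, hM]; ring
    rw [e]
    refine v.map_sub_le (by rwa [Valuation.map_neg]) ?_
    rw [map_mul]
    exact mul_le_of_le_one_of_le hb le_rfl
  have hDδ : v (M.det - 1) ≤ v δ := by
    simpa using up 1 (by simp [hD1]) (by simp) (by simpa using hcδ)
  have hbc : v (M 0 1 * M 1 0) ≤ v δ := by
    rw [map_mul]; exact mul_le_of_le_one_of_le hb hcδ
  have hdδ : v (M 1 1 - 1) ≤ v δ := by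
    have e : M 1 1 - 1 = (M.det - 1) + M 0 1 * M 1 0 := by rw [hdet]; ring
    rw [e]
    exact v.map_add_le hDδ hbc
  have hbd : v (M 0 1 * (1 - M 1 1) / M.det) ≤ v δ := by
    rw [map_div₀, hD1, div_one, map_mul, Valuation.map_sub_swap]
    exact mul_le_of_le_one_of_le hb hdδ
  -- The left factor is flip(M) M⁻¹, and the right factor is 1.
  refine Or.inr ⟨⟨!![(M 1 1 ^ 2 - M 0 1 * M 1 0) / M.det, M 0 1 * (1 - M 1 1) / M.det;
    M 1 0 * (M 1 1 - 1) / M.det, (1 - M 0 1 * M 1 0) / M.det], ?_⟩, ?_, 1, one_mem _, ?_, ?_⟩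
  · rw [Matrix.det_fin_two_of, div_mul_div_comm, div_mul_div_comm, ← sub_div,
      div_eq_one_iff_eq (mul_ne_zero hD hD), hdet]
    ring
  · have one_le : ∀ x : F, v (x - M.det) ≤ v δ → v (x / M.det - 1) ≤ v δ := fun x hx => by
      rw [← div_self hD, ← sub_div, map_div₀, hD1, div_one]
      exact hx
    refine mk_mem_gammaOne _ ?_ ?_ ?_ ?_
    · apply one_le
      have e : M 1 1 ^ 2 - M 0 1 * M 1 0 - M.det = M 1 1 * (M 1 1 - 1) := by rw [hdet]; ring
      rw [e, map_mul]
      exact mul_le_of_le_one_of_le hd hdδ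
    · exact hbd.trans hδ.le
    · rw [map_div₀, hD1, div_one, map_mul]
      exact mul_le_of_le_of_le_one hcδ (hdδ.trans hδ.le)
    · apply one_le
      have e : 1 - M 0 1 * M 1 0 - M.det = -(M 1 1 - 1) := by rw [hdet]; ring
      rw [e, Valuation.map_neg]
      exact hdδ
  · rw [Matrix.SpecialLinearGroup.coe_one, mul_one]
    ext i j
    fin_cases i <;> fin_cases j <;>
      simp [flipMatrix, Matrix.mul_apply, Fin.sum_univ_two, hM] <;> field_simp <;> rw [hdet] <;>
      ring
  · simpa using hψ.eq_one _ hbd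

/-- Flips and scalings preserve compatibility, which permits the normalisation a = 1 with d
integral. If a = d = 0, the conjugation case applies. -/
theorem HasConductor.flipCompatible (hψ : HasConductor v ψ δ)
    {M : Matrix (Fin 2) (Fin 2) F} (hD : M.det ≠ 0) :
    FlipCompatible (gammaOne v δ hδ) ψ M := by
  wlog hle : v (M 1 1) ≤ v (M 0 0) generalizing M
  · apply FlipCompatible.flip
    refine this (by rwa [det_flipMatrix]) ?_
    simpa [flipMatrix] using (not_le.1 hle).le
  rcases eq_or_ne (M 0 0) 0 with h0 | h0
  · apply HasConductor.flipCompatible_of_sub_le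
    have : M 1 1 = 0 := by simpa [h0] using hle
    simp [h0, this]
  · have key := (hψ.flipCompatible_of_zero_zero_eq_one (hδ := hδ) (M := (M 0 0)⁻¹ • M)
      (by simp [h0]) (by simp [h0, hD]) (by
        rw [Matrix.smul_apply, smul_eq_mul, map_mul, map_inv₀,
          inv_mul_le_iff₀ (zero_lt_iff.2 ((Valuation.ne_zero_iff v).2 h0)), mul_one]
        exact hle)).smul (M 0 0)
    rwa [smul_smul, mul_inv_cancel₀ h0, one_smul] at key

end Congruence

/-! ### Averaging projections for representations with finite orbits. -/

section Averaging

theorem apply_out_eq {K X : Type*} [Group K] {U : Subgroup K} {f : K → X} (hf : ∀ k, ∀ u ∈ U, f (k * u) = f k) (k : K) :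
    f ((k : K ⧸ U).out) = f k := by
  obtain ⟨u, hu⟩ := QuotientGroup.mk_out_eq_mul U k
  rw [hu, hf _ _ u.2]

variable {K V W : Type*} [Group K] [AddCommGroup V] [Module ℂ V] [AddCommGroup W] [Module ℂ W]

/-- The mean of a function over representatives of the left cosets of `U`. -/
noncomputable def quotientMean (V : Type*) [AddCommGroup V] [Module ℂ V]
    (U : Subgroup K) [U.FiniteIndex] : (K → V) →ₗ[ℂ] V :=
  let _ : Fintype (K ⧸ U) := Fintype.ofFinite _
  (U.index : ℂ)⁻¹ • ∑ q : K ⧸ U, LinearMap.proj q.out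

theorem quotientMean_apply (U : Subgroup K) [U.FiniteIndex] (f : K → V) :
    quotientMean V U f = (U.index : ℂ)⁻¹ •
      (letI : Fintype (K ⧸ U) := Fintype.ofFinite _; ∑ q : K ⧸ U, f q.out) := by
  simp [quotientMean]

theorem quotientMean_const (U : Subgroup K) [U.FiniteIndex] (w : V) :
    quotientMean V U (fun _ => w) = w := by
  let _ : Fintype (K ⧸ U) := Fintype.ofFinite _
  have h : (U.index : ℂ) ≠ 0 := Nat.cast_ne_zero.2 Subgroup.FiniteIndex.index_ne_zero
  have e : Fintype.card (K ⧸ U) = U.index := by rw [Subgroup.index, Nat.card_eq_fintype_card]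
  rw [quotientMean_apply, Finset.sum_const, Finset.card_univ, e, ← Nat.cast_smul_eq_nsmul ℂ,
    smul_smul, inv_mul_cancel₀ h, one_smul]

theorem map_quotientMean (U : Subgroup K) [U.FiniteIndex] (L : V →ₗ[ℂ] W) (f : K → V) :
    L (quotientMean V U f) = quotientMean W U (fun k => L (f k)) := by
  rw [quotientMean_apply, quotientMean_apply, map_smul, map_sum]

theorem quotientMean_mul_left (U : Subgroup K) [U.FiniteIndex] [U.Normal] {f : K → V}
    (hf : ∀ k, ∀ u ∈ U, f (k * u) = f k) (k₀ : K) :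
    quotientMean V U (fun k => f (k₀ * k)) = quotientMean V U f := by
  let _ : Fintype (K ⧸ U) := Fintype.ofFinite _
  rw [quotientMean_apply, quotientMean_apply]
  congr 1
  refine Fintype.sum_equiv (Equiv.mulLeft (k₀ : K ⧸ U)) _ _ fun q => ?_
  rw [Equiv.coe_mulLeft]
  conv_rhs => rw [← q.out_eq']
  exact (apply_out_eq hf (k₀ * q.out)).symm

theorem quotientMean_mul_right (U : Subgroup K) [U.FiniteIndex] [U.Normal] {f : K → V}
    (hf : ∀ k, ∀ u ∈ U, f (k * u) = f k) (k₀ : K) :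
    quotientMean V U (fun k => f (k * k₀)) = quotientMean V U f := by
  let _ : Fintype (K ⧸ U) := Fintype.ofFinite _
  rw [quotientMean_apply, quotientMean_apply]
  congr 1
  refine Fintype.sum_equiv (Equiv.mulRight (k₀ : K ⧸ U)) _ _ fun q => ?_
  rw [Equiv.coe_mulRight]
  conv_rhs => rw [← q.out_eq']
  exact (apply_out_eq hf (q.out * k₀)).symm

/-- The stabilizer of a vector. -/
def vectorStabilizer (ρ : Representation ℂ K V) (v : V) : Subgroup K where
  carrier := {k | ρ k v = v}
  one_mem' := by simp
  mul_mem' := by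
    intro a b ha hb
    simp only [Set.mem_ofPred_eq, map_mul, Module.End.mul_apply] at ha hb ⊢
    rw [hb, ha]
  inv_mem' := by
    intro a ha
    simp only [Set.mem_ofPred_eq] at ha ⊢
    conv_lhs => rw [← ha]
    rw [← Module.End.mul_apply, ← map_mul, inv_mul_cancel, map_one, Module.End.one_apply]

theorem mem_vectorStabilizer {ρ : Representation ℂ K V} {v : V} {k : K} :
    k ∈ vectorStabilizer ρ v ↔ ρ k v = v := Iff.rfl

/-- All stabilizers of vectors have finite index. -/
def HasFiniteOrbits (ρ : Representation ℂ K V) : Prop :=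
  ∀ v, (vectorStabilizer ρ v).FiniteIndex

variable {ρ : Representation ℂ K V}

theorem apply_mul_of_le_stabilizer {U : Subgroup K} {v : V} (hU : U ≤ vectorStabilizer ρ v) (k : K) :
    ∀ u ∈ U, ρ (k * u) v = ρ k v := fun u hu => by
  rw [map_mul, Module.End.mul_apply, mem_vectorStabilizer.1 (hU hu)]

theorem apply_quotientMean (U : Subgroup K) [U.FiniteIndex] [U.Normal] {v : V}
    (hU : U ≤ vectorStabilizer ρ v) (k : K) :
    ρ k (quotientMean V U (fun k => ρ k v)) = quotientMean V U (fun k => ρ k v) := by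
  rw [map_quotientMean, ← quotientMean_mul_left U (f := fun k => ρ k v)
    (fun k => apply_mul_of_le_stabilizer hU k) k]
  simp only [map_mul, Module.End.mul_apply]

theorem quotientMean_apply_apply (U : Subgroup K) [U.FiniteIndex] [U.Normal] {v : V}
    (hU : U ≤ vectorStabilizer ρ v) (k : K) :
    quotientMean V U (fun k' => ρ k' (ρ k v)) = quotientMean V U (fun k => ρ k v) := by
  rw [← quotientMean_mul_right U (f := fun k => ρ k v)
    (fun k => apply_mul_of_le_stabilizer hU k) k]
  simp only [map_mul, Module.End.mul_apply]

/-- Averaging over U' fixes the U-average, which is invariant, and takes the same value on every ρ k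
v. Applying it termwise to the U-average therefore gives the U'-average. -/
theorem quotientMean_eq_quotientMean (U U' : Subgroup K) [U.FiniteIndex] [U.Normal]
    [U'.FiniteIndex] [U'.Normal] {v : V} (hU : U ≤ vectorStabilizer ρ v)
    (hU' : U' ≤ vectorStabilizer ρ v) :
    quotientMean V U (fun k => ρ k v) = quotientMean V U' (fun k => ρ k v) := by
  let A : V →ₗ[ℂ] V := (quotientMean V U').comp (LinearMap.pi fun k => ρ k)
  have hA : ∀ w, A w = quotientMean V U' (fun k => ρ k w) := fun w => rfl
  have h1 : A (quotientMean V U (fun k => ρ k v)) = quotientMean V U (fun k => ρ k v) := by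
    rw [hA]
    simp only [apply_quotientMean U hU]
    exact quotientMean_const U' _
  rw [← h1, map_quotientMean]
  simp only [hA, quotientMean_apply_apply U' hU']
  exact quotientMean_const U _

/-- The projection onto the invariants of a representation with finite orbits. -/
noncomputable def invariantsProj (h : HasFiniteOrbits ρ) : V →ₗ[ℂ] V where
  toFun v := letI := h v
    quotientMean V (vectorStabilizer ρ v).normalCore (fun k => ρ k v)
  map_add' v w := by
    have := h v
    have := h w
    have := h (v + w)
    let U := (vectorStabilizer ρ v ⊓ vectorStabilizer ρ w).normalCore
    have h1 : U ≤ vectorStabilizer ρ v := (Subgroup.normalCore_le _).trans inf_le_left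
    have h2 : U ≤ vectorStabilizer ρ w := (Subgroup.normalCore_le _).trans inf_le_right
    have h3 : U ≤ vectorStabilizer ρ (v + w) := fun k hk => by
      rw [mem_vectorStabilizer, map_add, mem_vectorStabilizer.1 (h1 hk),
        mem_vectorStabilizer.1 (h2 hk)]
    rw [quotientMean_eq_quotientMean _ U (Subgroup.normalCore_le _) h3,
      quotientMean_eq_quotientMean _ U (Subgroup.normalCore_le _) h1,
      quotientMean_eq_quotientMean _ U (Subgroup.normalCore_le _) h2, ← map_add]
    congr 1
    ext k
    simp
  map_smul' c v := by
    have := h v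
    have := h (c • v)
    have h3 : (vectorStabilizer ρ v).normalCore ≤ vectorStabilizer ρ (c • v) := fun k hk => by
      rw [mem_vectorStabilizer, map_smul,
        mem_vectorStabilizer.1 ((Subgroup.normalCore_le _) hk)]
    rw [quotientMean_eq_quotientMean _ (vectorStabilizer ρ v).normalCore
      (Subgroup.normalCore_le _) h3, RingHom.id_apply, ← map_smul]
    congr 1
    ext k
    simp

variable (h : HasFiniteOrbits ρ)

theorem invariantsProj_eq (U : Subgroup K) [U.FiniteIndex] [U.Normal] {v : V}
    (hU : U ≤ vectorStabilizer ρ v) :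
    invariantsProj h v = quotientMean V U (fun k => ρ k v) :=
  have := h v
  quotientMean_eq_quotientMean _ U (Subgroup.normalCore_le _) hU

theorem apply_invariantsProj (k : K) (v : V) : ρ k (invariantsProj h v) = invariantsProj h v :=
  have := h v
  apply_quotientMean _ (Subgroup.normalCore_le _) k

theorem invariantsProj_apply (k : K) (v : V) : invariantsProj h (ρ k v) = invariantsProj h v := by
  have := h v
  have := h (ρ k v)
  let U := (vectorStabilizer ρ v ⊓ vectorStabilizer ρ (ρ k v)).normalCore
  have h1 : U ≤ vectorStabilizer ρ v := (Subgroup.normalCore_le _).trans inf_le_left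
  have h2 : U ≤ vectorStabilizer ρ (ρ k v) := (Subgroup.normalCore_le _).trans inf_le_right
  rw [invariantsProj_eq h U h1, invariantsProj_eq h U h2, quotientMean_apply_apply U h1]

theorem invariantsProj_of_fixed {v : V} (hv : ∀ k, ρ k v = v) : invariantsProj h v = v := by
  have := h v
  change quotientMean V _ _ = v
  simp only [hv]
  exact quotientMean_const _ _

theorem map_invariantsProj_eq_of_forall {L : V →ₗ[ℂ] W} {v : V} {w : W}
    (hL : ∀ k, L (ρ k v) = w) : L (invariantsProj h v) = w := by
  have := h v
  change L (quotientMean V _ _) = w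
  rw [map_quotientMean]
  simp only [hL]
  exact quotientMean_const _ _

variable {V' : Type*} [AddCommGroup V'] [Module ℂ V'] {ρ' : Representation ℂ K V'}

/-- The change of variable k ↦ θ(k) in an average over K, needed because the flip reverses products.
-/
theorem map_invariantsProj_eq_of_antihom (h' : HasFiniteOrbits ρ') {θ : K → K}
    (hθ : ∀ a b, θ (a * b) = θ b * θ a) (hθs : Function.Surjective θ)
    {L : V →ₗ[ℂ] W} {L' : V' →ₗ[ℂ] W} {v : V} {v' : V'}
    (hL : ∀ k, L (ρ k v) = L' (ρ' (θ k) v')) :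
    L (invariantsProj h v) = L' (invariantsProj h' v') := by
  have := h v
  have := h' v'
  -- Since k ↦ θ(k)⁻¹ is a homomorphism, preimages of finite index subgroups have finite index; this
  -- yields one U adapted to both orbits.
  let φ : K →* K := MonoidHom.mk' (fun k => (θ k)⁻¹) fun a b => by rw [hθ, _root_.mul_inv_rev]
  let U₂ := (vectorStabilizer ρ' v').normalCore.comap φ
  have : U₂.FiniteIndex := by
    refine ⟨?_⟩
    rw [Subgroup.index_comap]
    exact fun h0 => Subgroup.FiniteIndex.index_ne_zero (Subgroup.index_eq_zero_of_relIndex_eq_zero h0)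
  let U := (vectorStabilizer ρ v).normalCore ⊓ U₂
  have h1 : U ≤ vectorStabilizer ρ v := inf_le_left.trans (Subgroup.normalCore_le _)
  have h2 : ∀ k, ∀ u ∈ U, ρ' (θ (k * u)) v' = ρ' (θ k) v' := by
    intro k u hu
    have hu' : θ u ∈ (vectorStabilizer ρ' v').normalCore := by
      have : (θ u)⁻¹ ∈ (vectorStabilizer ρ' v').normalCore := hu.2
      simpa using inv_mem this
    have h3 := (Subgroup.normalCore_normal _).conj_mem _ hu' (θ k)⁻¹
    rw [inv_inv] at h3
    have h4 := mem_vectorStabilizer.1 (Subgroup.normalCore_le _ h3)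
    conv_rhs => rw [← h4, ← Module.End.mul_apply, ← map_mul]
    rw [hθ]
    congr 2
    group
  -- The θ-average is invariant because θ is onto, so projecting it changes nothing; projecting
  -- termwise gives the projection of v'.
  have key : quotientMean V' U (fun k => ρ' (θ k) v') = invariantsProj h' v' := by
    have hfix : ∀ k₀, ρ' k₀ (quotientMean V' U (fun k => ρ' (θ k) v'))
        = quotientMean V' U (fun k => ρ' (θ k) v') := by
      intro k₀
      obtain ⟨k₁, rfl⟩ := hθs k₀
      rw [map_quotientMean, ← quotientMean_mul_right U (f := fun k => ρ' (θ k) v') h2 k₁]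
      simp only [hθ, map_mul, Module.End.mul_apply]
    rw [← invariantsProj_of_fixed h' hfix, map_quotientMean]
    simp only [invariantsProj_apply]
    exact quotientMean_const U _
  rw [invariantsProj_eq h U h1, ← key, map_quotientMean, map_quotientMean]
  simp only [hL]

end Averaging

/-! ### Irreducible representations sharing a matrix coefficient. -/

section Irreducible

variable {G V V' W : Type*} [Group G] [AddCommGroup V] [Module ℂ V] [AddCommGroup V'] [Module ℂ V']
  [AddCommGroup W] [Module ℂ W]

theorem Representation.IsIrreducible.eq_top_of_ne_bot {π : Representation ℂ G V}
    (hπ : π.IsIrreducible) {p : Submodule ℂ V} (hp : ∀ g, ∀ v ∈ p, π g v ∈ p) (hne : p ≠ ⊥) :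
    p = ⊤ := by
  let P : Subrepresentation π := ⟨p, fun g v hv => hp g v hv⟩
  rcases hπ.eq_bot_or_eq_top P with h | h
  · exact absurd (congrArg Subrepresentation.toSubmodule h) hne
  · exact congrArg Subrepresentation.toSubmodule h

/-- The orbit map `∑ c_g [g] ↦ ∑ c_g π(g) v`. -/
noncomputable def orbitMap (π : Representation ℂ G V) (v : V) : (G →₀ ℂ) →ₗ[ℂ] V :=
  Finsupp.linearCombination ℂ fun g => π g v

theorem orbitMap_single (π : Representation ℂ G V) (v : V) (g : G) (c : ℂ) :
    orbitMap π v (Finsupp.single g c) = c • π g v := by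
  simp [orbitMap]

theorem orbitMap_translate (π : Representation ℂ G V) (v : V) (g : G) (f : G →₀ ℂ) :
    orbitMap π v (Finsupp.lmapDomain ℂ ℂ (g * ·) f) = π g (orbitMap π v f) := by
  induction f using Finsupp.induction_linear with
  | zero => simp
  | add f f' hf hf' => simp only [map_add, hf, hf']
  | single a b => simp [orbitMap_single, Finsupp.lmapDomain_apply, Finsupp.mapDomain_single]

theorem orbitMap_surjective {π : Representation ℂ G V} (hπ : π.IsIrreducible) {v : V}
    (hv : v ≠ 0) : Function.Surjective (orbitMap π v) := by
  rw [← LinearMap.range_eq_top]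
  refine hπ.eq_top_of_ne_bot ?_ ?_
  · rintro g _ ⟨f, rfl⟩
    exact ⟨_, orbitMap_translate π v g f⟩
  · refine fun h => hv ?_
    have : v ∈ LinearMap.range (orbitMap π v) := ⟨Finsupp.single 1 1, by simp [orbitMap_single]⟩
    rwa [h, Submodule.mem_bot] at this

/-- Two irreducible representations with a common matrix coefficient are equivalent. -/
theorem Representation.nonempty_equiv_of_matrixCoeff {π : Representation ℂ G V}
    {π' : Representation ℂ G V'} (hπ : π.IsIrreducible) (hπ' : π'.IsIrreducible)
    {A : V →ₗ[ℂ] W} {B : V' →ₗ[ℂ] W} {v : V} {w : V'}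
    (hAB : ∀ g, A (π g v) = B (π' g w)) (hB : B w ≠ 0) : Nonempty (π.Equiv π') := by
  have hw : w ≠ 0 := fun h => hB (by rw [h, map_zero])
  have hv : v ≠ 0 := fun h => hB (by
    have := hAB 1
    simpa [h] using this.symm)
  have hcomp : ∀ f, A (orbitMap π v f) = B (orbitMap π' w f) := by
    intro f
    induction f using Finsupp.induction_linear with
    | zero => simp
    | add f f' hf hf' => simp only [map_add, hf, hf']
    | single a b => simp [orbitMap_single, hAB]
  have hsurj := orbitMap_surjective hπ hv
  -- Otherwise the image of the kernel is a nonzero invariant subspace of V', so it contains w: some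
  -- f kills v and sends w to w, whence B w = A 0 = 0.
  have hker : LinearMap.ker (orbitMap π v) ≤ LinearMap.ker (orbitMap π' w) := by
    by_contra hne
    have htop : (LinearMap.ker (orbitMap π v)).map (orbitMap π' w) = ⊤ := by
      refine hπ'.eq_top_of_ne_bot ?_ ?_
      · rintro g _ ⟨f, hf, rfl⟩
        refine ⟨_, ?_, orbitMap_translate π' w g f⟩
        rw [SetLike.mem_coe, LinearMap.mem_ker] at hf ⊢
        rw [orbitMap_translate, hf, map_zero]
      · rwa [Ne, ← LinearMap.le_ker_iff_map]
    obtain ⟨f, hf, hfw⟩ : w ∈ (LinearMap.ker (orbitMap π v)).map (orbitMap π' w) := by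
      rw [htop]; trivial
    apply hB
    rw [← hfw, ← hcomp, LinearMap.mem_ker.1 hf, map_zero]
  let φ : V →ₗ[ℂ] V' := ((LinearMap.ker (orbitMap π v)).liftQ (orbitMap π' w) hker).comp
    ((orbitMap π v).quotKerEquivOfSurjective hsurj).symm.toLinearMap
  have hφ : ∀ f, φ (orbitMap π v f) = orbitMap π' w f := by
    intro f
    have : ((orbitMap π v).quotKerEquivOfSurjective hsurj).symm (orbitMap π v f)
        = Submodule.Quotient.mk f := by
      rw [LinearEquiv.symm_apply_eq]
      rfl
    simp only [φ, LinearMap.comp_apply, LinearEquiv.coe_coe, this]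
    exact Submodule.liftQ_apply _ _ _
  let Φ : Representation.IntertwiningMap π π' := ⟨φ, fun g => by
    ext x
    obtain ⟨f, rfl⟩ := hsurj x
    change φ (π g (orbitMap π v f)) = π' g (φ (orbitMap π v f))
    rw [← orbitMap_translate, hφ, hφ, orbitMap_translate]⟩
  have hΦ : Φ ≠ 0 := by
    intro h0
    apply hw
    have h1 : φ v = w := by
      have := hφ (Finsupp.single 1 1)
      simpa [orbitMap_single] using this
    rw [← h1]
    exact congrArg (fun F : Representation.IntertwiningMap π π' => F v) h0
  have := hπ
  have := hπ'
  exact ⟨Φ.ofBijective ((Representation.IsIrreducible.bijective_or_eq_zero Φ).resolve_right hΦ)⟩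

end Irreducible

/-! ### Structure of U(1,1) and of the coset α(κ)U(1,1). -/

section UnitaryGroupElements

variable {F E : Type*} [Field F] [Field E] [Algebra F E]

/-- For two by two matrices g J ᵗg = det(g) J, so the unitary relation says that g and σ(g) are
proportional. Ratios of entries are then fixed by σ. -/
theorem mem_U11_iff_eq_det_mul (σ : E ≃ₐ[F] E) (g : GL (Fin 2) E) :
    g ∈ U11 σ ↔ ∀ i j, (g : Matrix (Fin 2) (Fin 2) E) i j
      = (g : Matrix (Fin 2) (Fin 2) E).det * σ ((g : Matrix (Fin 2) (Fin 2) E) i j) := by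
  have hdet : (g : Matrix (Fin 2) (Fin 2) E).det ≠ 0 := by
    rw [← GeneralLinearGroup.val_det_apply]
    exact Units.ne_zero _
  rw [mem_U11]
  generalize (g : Matrix (Fin 2) (Fin 2) E) = M at *
  have hform : M * skewJ E * (M.map σ)ᵀ =
      !![M 0 0 * σ (M 0 1) - M 0 1 * σ (M 0 0), M 0 0 * σ (M 1 1) - M 0 1 * σ (M 1 0);
        M 1 0 * σ (M 0 1) - M 1 1 * σ (M 0 0), M 1 0 * σ (M 1 1) - M 1 1 * σ (M 1 0)] := by
    ext i j
    fin_cases i <;> fin_cases j <;>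
      simp [skewJ, Matrix.mul_apply, Fin.sum_univ_two] <;> ring
  rw [hform, Matrix.det_fin_two]
  rw [Matrix.det_fin_two] at hdet
  constructor
  · intro h
    have h00 := congrFun (congrFun h 0) 0
    have h01 := congrFun (congrFun h 0) 1
    have h10 := congrFun (congrFun h 1) 0
    have h11 := congrFun (congrFun h 1) 1
    simp only [skewJ, Matrix.of_apply, Matrix.cons_val', Matrix.cons_val_zero, Matrix.cons_val_one,
      Matrix.cons_val_fin_one] at h00 h01 h10 h11
    intro i j
    fin_cases i <;> fin_cases j <;> simp only [Fin.zero_eta, Fin.mk_one]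
    · linear_combination -M 1 0 * h00 + M 0 0 * h10
    · linear_combination -M 1 1 * h00 + M 0 1 * h10
    · linear_combination -M 1 0 * h01 + M 0 0 * h11
    · linear_combination -M 1 1 * h01 + M 0 1 * h11
  · intro h
    have key : ∀ i j k l : Fin 2, (M 0 0 * M 1 1 - M 0 1 * M 1 0) * (M i j * σ (M k l))
        = M i j * M k l := by
      intro i j k l
      rw [mul_left_comm, ← h k l]
    ext i j
    fin_cases i <;> fin_cases j <;> apply mul_left_cancel₀ hdet <;> simp [skewJ, mul_sub, key]
    all_goals ring

/-- If y were not in F, then 1, y would be a basis fixed by σ. -/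
theorem mem_range_algebraMap_of_fixed [Algebra.IsQuadraticExtension F E] {σ : E ≃ₐ[F] E}
    (hσ : σ ≠ AlgEquiv.refl) {y : E} (hy : σ y = y) : y ∈ Set.range (algebraMap F E) := by
  by_contra hne
  apply hσ
  have hli : LinearIndependent F ![1, y] := by
    rw [LinearIndependent.pair_iff]
    intro s t hst
    have ht : t = 0 := by
      by_contra ht
      apply hne
      refine ⟨-(s / t), ?_⟩
      have ht' : algebraMap F E t ≠ 0 := by simpa using ht
      rw [Algebra.smul_def, Algebra.smul_def, mul_one] at hst
      rw [map_neg, map_div₀, ← neg_div, div_eq_iff ht']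
      linear_combination -hst
    refine ⟨?_, ht⟩
    simpa [ht] using hst
  have hcard : Fintype.card (Fin 2) = Module.finrank F E := by
    rw [Algebra.IsQuadraticExtension.finrank_eq_two, Fintype.card_fin]
  let b := basisOfLinearIndependentOfCardEqFinrank hli hcard
  have : σ.toLinearMap = (AlgEquiv.refl : E ≃ₐ[F] E).toLinearMap := by
    refine b.ext fun i => ?_
    fin_cases i <;> simp [b, hy]
  ext x
  exact congrArg (fun f : E →ₗ[F] E => f x) this

/-- An element of `U(1,1)` is a scalar multiple of a matrix over the base field. -/
theorem exists_eq_smul_map [Algebra.IsQuadraticExtension F E] {σ : E ≃ₐ[F] E}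
    (hσ : σ ≠ AlgEquiv.refl) (h : U11 σ) :
    ∃ (e : E) (M : Matrix (Fin 2) (Fin 2) F), M.det ≠ 0 ∧
      ((h : GL (Fin 2) E) : Matrix (Fin 2) (Fin 2) E) = e • M.map (algebraMap F E) := by
  have hdet : ((h : GL (Fin 2) E) : Matrix (Fin 2) (Fin 2) E).det ≠ 0 := by
    rw [← GeneralLinearGroup.val_det_apply]
    exact Units.ne_zero _
  have hh := (mem_U11_iff_eq_det_mul σ _).1 h.2
  generalize ((h : GL (Fin 2) E) : Matrix (Fin 2) (Fin 2) E) = A at *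
  obtain ⟨i₀, j₀, he⟩ : ∃ i j, A i j ≠ 0 := by
    by_contra! h0
    apply hdet
    simp [Matrix.det_fin_two, h0]
  have hσA : ∀ i j, σ (A i j) = A i j / A.det := fun i j => by
    rw [eq_div_iff hdet, mul_comm, ← hh i j]
  have hfix : ∀ i j, ∃ m, algebraMap F E m = A i j / A i₀ j₀ := fun i j => by
    refine mem_range_algebraMap_of_fixed hσ ?_
    rw [map_div₀, hσA, hσA, div_div_div_cancel_right₀ hdet]
  choose M hM using hfix
  have hA : A = A i₀ j₀ • (Matrix.of M).map (algebraMap F E) := by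
    ext i j
    rw [Matrix.smul_apply, Matrix.map_apply, Matrix.of_apply, hM, smul_eq_mul,
      mul_div_cancel₀ _ he]
  refine ⟨A i₀ j₀, Matrix.of M, ?_, hA⟩
  intro h0
  apply hdet
  rw [hA, Matrix.det_smul, ← RingHom.mapMatrix_apply, ← RingHom.map_det, h0, map_zero, mul_zero]

/-- The inclusion of `SL₂(F)` in `U(1,1)`. -/
def slToU11 (σ : E ≃ₐ[F] E) : SpecialLinearGroup (Fin 2) F →* U11 σ :=
  (Matrix.SpecialLinearGroup.toGL.comp
    (Matrix.SpecialLinearGroup.map (algebraMap F E))).codRestrict (U11 σ) fun g => by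
    rw [mem_U11_iff_eq_det_mul]
    intro i j
    have hM : ((((Matrix.SpecialLinearGroup.toGL).comp
        (Matrix.SpecialLinearGroup.map (algebraMap F E))) g : GL (Fin 2) E) :
          Matrix (Fin 2) (Fin 2) E) = (g : Matrix (Fin 2) (Fin 2) F).map (algebraMap F E) := rfl
    rw [hM, ← RingHom.mapMatrix_apply, ← RingHom.map_det, g.det_coe]
    simp

theorem coe_slToU11 (σ : E ≃ₐ[F] E) (g : SpecialLinearGroup (Fin 2) F) :
    ((slToU11 σ g : GL (Fin 2) E) : Matrix (Fin 2) (Fin 2) E)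
      = (g : Matrix (Fin 2) (Fin 2) F).map (algebraMap F E) := rfl

theorem slToU11_upper (σ : E ≃ₐ[F] E) (x : F)
    (hx : (!![1, x; 0, 1] : Matrix (Fin 2) (Fin 2) F).det = 1) :
    slToU11 σ ⟨!![1, x; 0, 1], hx⟩ = unipotent σ x := by
  apply Subtype.ext
  apply Units.ext
  refine (coe_slToU11 σ _).trans ?_
  ext i j
  fin_cases i <;> fin_cases j <;> simp [unipotent]

/-- The anti-involution `flipMatrix` on `U(1,1)`. -/
def flipU11 {σ : E ≃ₐ[F] E} (g : U11 σ) : U11 σ :=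
  ⟨GeneralLinearGroup.mkOfDetNeZero
    (flipMatrix ((g : GL (Fin 2) E) : Matrix (Fin 2) (Fin 2) E)) (by
      rw [det_flipMatrix, ← GeneralLinearGroup.val_det_apply]
      exact Units.ne_zero _), by
    have hg := (mem_U11_iff_eq_det_mul σ _).1 g.2
    rw [mem_U11_iff_eq_det_mul]
    have e : ((GeneralLinearGroup.mkOfDetNeZero
      (flipMatrix ((g : GL (Fin 2) E) : Matrix (Fin 2) (Fin 2) E)) (by
        rw [det_flipMatrix, ← GeneralLinearGroup.val_det_apply]
        exact Units.ne_zero _) : GL (Fin 2) E) : Matrix (Fin 2) (Fin 2) E)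
        = flipMatrix ((g : GL (Fin 2) E) : Matrix (Fin 2) (Fin 2) E) := rfl
    rw [e, det_flipMatrix]
    intro i j
    fin_cases i <;> fin_cases j <;> simpa [flipMatrix] using hg _ _⟩

theorem coe_flipU11 {σ : E ≃ₐ[F] E} (g : U11 σ) :
    ((flipU11 g : GL (Fin 2) E) : Matrix (Fin 2) (Fin 2) E)
      = flipMatrix ((g : GL (Fin 2) E) : Matrix (Fin 2) (Fin 2) E) := rfl

theorem coe_alphaKappa (κ : Fˣ) : ((alphaKappa E κ : GL (Fin 2) E) : Matrix (Fin 2) (Fin 2) E)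
    = (!![(κ : F), 0; 0, 1] : Matrix (Fin 2) (Fin 2) F).map (algebraMap F E) := by
  ext i j
  fin_cases i <;> fin_cases j <;> simp [alphaKappa]

theorem alphaKappa_mul (κ κ' : Fˣ) :
    alphaKappa E (κ * κ') = alphaKappa E κ * alphaKappa E κ' := by
  apply Units.ext
  rw [Units.val_mul, coe_alphaKappa, coe_alphaKappa, coe_alphaKappa, ← Matrix.map_mul]
  congr 1
  ext i j
  fin_cases i <;> fin_cases j <;> simp

theorem alphaKappa_one : alphaKappa E (1 : Fˣ) = 1 := by
  apply Units.ext
  rw [coe_alphaKappa]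
  ext i j
  fin_cases i <;> fin_cases j <;> simp

theorem alphaKappa_inv (κ : Fˣ) : alphaKappa E κ⁻¹ = (alphaKappa E κ)⁻¹ := by
  rw [eq_inv_iff_mul_eq_one, ← alphaKappa_mul, inv_mul_cancel, alphaKappa_one]

theorem coe_kappaConj (σ : E ≃ₐ[F] E) (κ : Fˣ) (h : U11 σ) :
    (kappaConj σ κ h : GL (Fin 2) E) = alphaKappa E κ * h * (alphaKappa E κ)⁻¹ := rfl

theorem kappaConj_kappaConj (σ : E ≃ₐ[F] E) (κ κ' : Fˣ) (h : U11 σ) :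
    kappaConj σ κ (kappaConj σ κ' h) = kappaConj σ (κ * κ') h := by
  apply Subtype.ext
  simp only [coe_kappaConj, alphaKappa_mul, _root_.mul_inv_rev, mul_assoc]

theorem kappaConj_one (σ : E ≃ₐ[F] E) (h : U11 σ) : kappaConj σ 1 h = h := by
  apply Subtype.ext
  simp [coe_kappaConj, alphaKappa_one]

theorem kappaConj_kappaConj_inv (σ : E ≃ₐ[F] E) (κ : Fˣ) (h : U11 σ) :
    kappaConj σ κ (kappaConj σ κ⁻¹ h) = h := by
  rw [kappaConj_kappaConj, mul_inv_cancel, kappaConj_one]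

theorem kappaConj_surjective (σ : E ≃ₐ[F] E) (κ : Fˣ) : Function.Surjective (kappaConj σ κ) :=
  fun h => ⟨_, kappaConj_kappaConj_inv σ κ h⟩

theorem alphaKappa_mul_kappaConj_inv (σ : E ≃ₐ[F] E) (κ : Fˣ) (h : U11 σ) :
    alphaKappa E κ * (kappaConj σ κ⁻¹ h : GL (Fin 2) E) = h * alphaKappa E κ := by
  rw [coe_kappaConj, alphaKappa_inv]
  group

/-- The action of the anti-involution `flipMatrix` on the coset `α(κ) U(1,1)`. -/
theorem exists_flip_alphaKappa_mul {σ : E ≃ₐ[F] E} (κ : Fˣ) (h : U11 σ) :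
    ∃ h' : U11 σ, ((alphaKappa E κ * h' : GL (Fin 2) E) : Matrix (Fin 2) (Fin 2) E)
      = flipMatrix ((alphaKappa E κ * h : GL (Fin 2) E) : Matrix (Fin 2) (Fin 2) E) := by
  -- The flip of α(κ) is diag(1, κ) = α(κ)D, so the flip of α(κ)h is flip(h) α(κ) D, and α(κ) moves
  -- left by conjugation.
  let D : SpecialLinearGroup (Fin 2) F := ⟨!![(κ : F)⁻¹, 0; 0, κ], by simp [Matrix.det_fin_two]⟩
  refine ⟨kappaConj σ κ⁻¹ (flipU11 h) * slToU11 σ D, ?_⟩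
  rw [Subgroup.coe_mul, ← mul_assoc, alphaKappa_mul_kappaConj_inv]
  simp only [Units.val_mul, coe_flipU11, coe_slToU11, coe_alphaKappa, flipMatrix_mul,
    flipMatrix_map]
  rw [mul_assoc, ← Matrix.map_mul]
  congr 2
  ext i j
  fin_cases i <;> fin_cases j <;> simp [D, flipMatrix]

theorem kappaTwist_apply {V : Type*} [AddCommGroup V] [Module ℂ V] (σ : E ≃ₐ[F] E) (κ : Fˣ)
    (π : Representation ℂ (U11 σ) V) (h : U11 σ) :
    kappaTwist σ κ π h = π (kappaConj σ κ h) := rfl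

theorem kappaTwist_kappaTwist {V : Type*} [AddCommGroup V] [Module ℂ V] (σ : E ≃ₐ[F] E)
    (κ κ' : Fˣ) (π : Representation ℂ (U11 σ) V) :
    kappaTwist σ κ (kappaTwist σ κ' π) = kappaTwist σ (κ' * κ) π := by
  ext1 h
  rw [kappaTwist_apply, kappaTwist_apply, kappaTwist_apply, kappaConj_kappaConj]

theorem kappaTwist_one {V : Type*} [AddCommGroup V] [Module ℂ V] (σ : E ≃ₐ[F] E)
    (π : Representation ℂ (U11 σ) V) : kappaTwist σ 1 π = π := by
  ext1 h
  rw [kappaTwist_apply, kappaConj_one]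

theorem isIrreducible_kappaTwist {V : Type*} [AddCommGroup V] [Module ℂ V] {σ : E ≃ₐ[F] E}
    {π : Representation ℂ (U11 σ) V} (hπ : π.IsIrreducible) (κ : Fˣ) :
    (kappaTwist σ κ π).IsIrreducible := by
  let f : Subrepresentation (kappaTwist σ κ π) ≃o Subrepresentation π :=
    { toFun := fun P => ⟨P.toSubmodule, fun g v hv => by
        obtain ⟨g, rfl⟩ := kappaConj_surjective σ κ g
        exact P.apply_mem_toSubmodule g hv⟩
      invFun := fun P => ⟨P.toSubmodule, fun g v hv => P.apply_mem_toSubmodule _ hv⟩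
      left_inv := fun P => rfl
      right_inv := fun P => rfl
      map_rel_iff' := Iff.rfl }
  have := hπ
  exact f.isSimpleOrder

end UnitaryGroupElements

/-! ### Eigenvectors of the congruence subgroup and the commutation identity. -/

section TwistedRestriction

variable {F E Γ₀ V : Type*} [Field F] [Field E] [Algebra F E] [LinearOrderedCommGroupWithZero Γ₀]
  [AddCommGroup V] [Module ℂ V] {v : Valuation F Γ₀} {δ : F} {hδ : v δ < 1}
  {ψ : AddChar F Circle} {σ : E ≃ₐ[F] E}

/-- On K the upper right entry is additive modulo δ. -/
theorem HasConductor.apply_mul_upper (hψ : HasConductor v ψ δ) {k k' : SpecialLinearGroup (Fin 2) F}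
    (hk : k ∈ gammaOne v δ hδ) (hk' : k' ∈ gammaOne v δ hδ) :
    ψ ((k * k').1 0 1) = ψ (k.1 0 1) * ψ (k'.1 0 1) := by
  obtain ⟨h1, h2, -, -⟩ := mem_gammaOne.1 hk
  obtain ⟨-, h2', -, h4'⟩ := mem_gammaOne.1 hk'
  rw [← AddChar.map_add_eq_mul]
  apply hψ.eq_of_le
  rw [Matrix.SpecialLinearGroup.coe_mul, Matrix.mul_apply, Fin.sum_univ_two]
  have e : k.1 0 0 * k'.1 0 1 + k.1 0 1 * k'.1 1 1 - (k.1 0 1 + k'.1 0 1)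
    = (k.1 0 0 - 1) * k'.1 0 1 + k.1 0 1 * (k'.1 1 1 - 1) := by ring
  rw [e]
  refine v.map_add_le ?_ ?_ <;> rw [map_mul]
  · exact mul_le_of_le_of_le_one h1 h2'
  · exact mul_le_of_le_one_of_le h2 h4'

/-- The restriction of `π` to the congruence subgroup, twisted so that its invariants are the
vectors on which `k` acts by `ψ (k₀₁)`. -/
noncomputable def twistedRestriction (hψ : HasConductor v ψ δ) (hδ : v δ < 1)
    (π : Representation ℂ (U11 σ) V) : Representation ℂ (gammaOne v δ hδ) V where
  toFun k := ((ψ (k.1.1 0 1))⁻¹ : Circle).1 • π (slToU11 σ k)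
  map_one' := by simp
  map_mul' k k' := by
    rw [Subgroup.coe_mul, hψ.apply_mul_upper k.2 k'.2, map_mul, map_mul, mul_inv, smul_mul_smul_comm]
    simp

theorem twistedRestriction_apply (hψ : HasConductor v ψ δ)
    (π : Representation ℂ (U11 σ) V) (k : gammaOne v δ hδ) (x : V) :
    twistedRestriction hψ hδ π k x = ((ψ (k.1.1 0 1))⁻¹ : Circle).1 • π (slToU11 σ k) x := rfl

theorem apply_slToU11_eq (hψ : HasConductor v ψ δ)
    (π : Representation ℂ (U11 σ) V) (k : gammaOne v δ hδ) (x : V) :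
    π (slToU11 σ k) x = (ψ (k.1.1 0 1)).1 • twistedRestriction hψ hδ π k x := by
  rw [twistedRestriction_apply, smul_smul, Circle.coe_inv, mul_inv_cancel₀, one_smul]
  exact Circle.coe_ne_zero _

variable {hψ : HasConductor v ψ δ} {κ : Fˣ} {π π' : Representation ℂ (U11 σ) V}

/-- The eigenvector u absorbs k on the right and the projection absorbs k' on the left, each at the
cost of its character. M' = M gives vanishing; M' = flip(M) gives flip invariance. -/
theorem smul_invariantsProj_eq (hπ' : π' = kappaTwist σ κ⁻¹ π)
    (hfin : HasFiniteOrbits (twistedRestriction hψ hδ π')) {u : V}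
    (hu : ∀ k, twistedRestriction hψ hδ π k u = u) {e : E} {M M' : Matrix (Fin 2) (Fin 2) F}
    {x x' : U11 σ}
    (hx : ((alphaKappa E κ * x : GL (Fin 2) E) : Matrix (Fin 2) (Fin 2) E)
      = e • M.map (algebraMap F E))
    (hx' : ((alphaKappa E κ * x' : GL (Fin 2) E) : Matrix (Fin 2) (Fin 2) E)
      = e • M'.map (algebraMap F E))
    {k k' : SpecialLinearGroup (Fin 2) F} (hk : k ∈ gammaOne v δ hδ) (hk' : k' ∈ gammaOne v δ hδ)
    (h : M * k.1 = k'.1 * M') :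
    (ψ (k.1 0 1)).1 • invariantsProj hfin (π x u)
      = (ψ (k'.1 0 1)).1 • invariantsProj hfin (π x' u) := by
  have hmul : x * slToU11 σ k = kappaConj σ κ⁻¹ (slToU11 σ k') * x' := by
    apply Subtype.ext
    apply mul_left_cancel (a := alphaKappa E κ)
    rw [Subgroup.coe_mul, Subgroup.coe_mul, ← mul_assoc, ← mul_assoc,
      alphaKappa_mul_kappaConj_inv, mul_assoc (slToU11 σ k' : GL (Fin 2) E)]
    apply Units.ext
    rw [Units.val_mul _ (slToU11 σ k : GL (Fin 2) E), hx,
      Units.val_mul (slToU11 σ k' : GL (Fin 2) E), hx', coe_slToU11, coe_slToU11, Matrix.smul_mul,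
      Matrix.mul_smul, ← Matrix.map_mul, ← Matrix.map_mul, h]
  have h1 := congrArg (fun y => invariantsProj hfin (π y u)) hmul
  simp only [map_mul, Module.End.mul_apply] at h1
  have h2 : π (slToU11 σ k) u = (ψ (k.1 0 1)).1 • u := by
    rw [apply_slToU11_eq hψ π ⟨k, hk⟩, hu]
  have h3 : π (kappaConj σ κ⁻¹ (slToU11 σ k')) (π x' u)
      = (ψ (k'.1 0 1)).1 • twistedRestriction hψ hδ π' ⟨k', hk'⟩ (π x' u) := by
    rw [← kappaTwist_apply, ← hπ', apply_slToU11_eq hψ π' ⟨k', hk'⟩]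
  rw [h2, h3, map_smul, map_smul, map_smul, invariantsProj_apply] at h1
  exact h1

/-- In the first alternative of `FlipCompatible` both sides vanish; in the second the two characters
cancel. -/
theorem invariantsProj_flip_eq [Algebra.IsQuadraticExtension F E] (hσ : σ ≠ AlgEquiv.refl)
    (hπ' : π' = kappaTwist σ κ⁻¹ π)
    (hfin : HasFiniteOrbits (twistedRestriction hψ hδ π')) {u : V}
    (hu : ∀ k, twistedRestriction hψ hδ π k u = u) {x x' : U11 σ}
    (hx : ((alphaKappa E κ * x' : GL (Fin 2) E) : Matrix (Fin 2) (Fin 2) E)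
      = flipMatrix ((alphaKappa E κ * x : GL (Fin 2) E) : Matrix (Fin 2) (Fin 2) E)) :
    invariantsProj hfin (π x u) = invariantsProj hfin (π x' u) := by
  obtain ⟨e, M₀, hM₀, hxM₀⟩ := exists_eq_smul_map hσ x
  set M : Matrix (Fin 2) (Fin 2) F := !![(κ : F), 0; 0, 1] * M₀ with hM
  have hdet : M.det ≠ 0 := by
    rw [hM, Matrix.det_mul]
    exact mul_ne_zero (by simp [Matrix.det_fin_two]) hM₀
  have hxM : ((alphaKappa E κ * x : GL (Fin 2) E) : Matrix (Fin 2) (Fin 2) E)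
      = e • M.map (algebraMap F E) := by
    rw [Units.val_mul, hxM₀, coe_alphaKappa, Matrix.mul_smul, ← Matrix.map_mul]
  have hxM' : ((alphaKappa E κ * x' : GL (Fin 2) E) : Matrix (Fin 2) (Fin 2) E)
      = e • (flipMatrix M).map (algebraMap F E) := by
    rw [hx, hxM, flipMatrix_smul, flipMatrix_map]
  have vanish : ∀ {a b : Circle} {w : V}, a ≠ b → a.1 • w = b.1 • w → w = 0 := by
    intro a b w hab h
    by_contra hw
    exact hab (Subtype.ext (smul_left_injective ℂ hw h))
  rcases hψ.flipCompatible (hδ := hδ) hdet with ⟨k, hk, k', hk', h, hne⟩ | ⟨k₁, h₁, k₂, h₂, h, hone⟩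
  · rw [vanish hne (smul_invariantsProj_eq hπ' hfin hu hxM hxM hk hk' h)]
    have h' : flipMatrix M * (flipSL k').1 = (flipSL k).1 * flipMatrix M := by
      rw [coe_flipSL, coe_flipSL, ← flipMatrix_mul, ← flipMatrix_mul, h]
    have hne' : ψ ((flipSL k').1 0 1) ≠ ψ ((flipSL k).1 0 1) := by
      simpa [coe_flipSL, flipMatrix] using hne.symm
    exact (vanish hne' (smul_invariantsProj_eq hπ' hfin hu hxM' hxM' (flipSL_mem_gammaOne hk')
      (flipSL_mem_gammaOne hk) h')).symm
  · have e1 : (k₁⁻¹).1 * k₁.1 = 1 := congrArg Subtype.val (inv_mul_cancel k₁)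
    have h' : M * k₂.1 = (k₁⁻¹).1 * flipMatrix M := by
      rw [h, ← Matrix.mul_assoc, ← Matrix.mul_assoc, e1, one_mul]
    have h3 := smul_invariantsProj_eq hπ' hfin hu hxM hxM' h₂ (inv_mem h₁) h'
    have e2 : ψ ((k₁⁻¹).1 0 1) = ψ (k₂.1 0 1) := by
      have : (k₁⁻¹).1 0 1 = - k₁.1 0 1 := by
        simp [Matrix.SpecialLinearGroup.coe_inv, Matrix.adjugate_fin_two]
      rw [this, AddChar.map_neg_eq_inv, inv_eq_iff_mul_eq_one, hone]
    rw [e2] at h3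
    exact smul_right_injective V (Circle.coe_ne_zero _) h3

/-- Write the inner projection as an average over k. The flip turns α(κ)hkg into flip(g) flip(k)
α(κ)h', and k ↦ flip(k) is an anti-automorphism of K, so the average becomes a projection in π'. The
flips of h and g are then undone separately. -/
theorem invariantsProj_commute [Algebra.IsQuadraticExtension F E] (hσ : σ ≠ AlgEquiv.refl)
    (hπ' : π' = kappaTwist σ κ⁻¹ π)
    (hfin : HasFiniteOrbits (twistedRestriction hψ hδ π))
    (hfin' : HasFiniteOrbits (twistedRestriction hψ hδ π')) {u : V}
    (hu : ∀ k, twistedRestriction hψ hδ π k u = u) (h g : U11 σ) :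
    invariantsProj hfin' (π h (invariantsProj hfin (π g u)))
      = invariantsProj hfin' (π' g (invariantsProj hfin' (π h u))) := by
  subst hπ'
  obtain ⟨h', hh'⟩ := exists_flip_alphaKappa_mul κ h
  let θ : gammaOne v δ hδ → gammaOne v δ hδ := fun k => ⟨flipSL k.1, flipSL_mem_gammaOne k.2⟩
  have hθ : ∀ a b, θ (a * b) = θ b * θ a := fun a b => Subtype.ext (flipSL_mul a.1 b.1)
  have hθs : Function.Surjective θ := fun a => ⟨θ a, Subtype.ext (flipSL_flipSL a.1)⟩
  have step1 : invariantsProj hfin' (π h (invariantsProj hfin (π g u)))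
      = invariantsProj hfin' (kappaTwist σ κ⁻¹ π (flipU11 g) (invariantsProj hfin' (π h' u))) := by
    refine map_invariantsProj_eq_of_antihom (L := (invariantsProj hfin').comp (π h))
      (L' := (invariantsProj hfin').comp (kappaTwist σ κ⁻¹ π (flipU11 g))) hfin hfin' hθ hθs fun k => ?_
    have e01 : (θ k).1.1 0 1 = k.1.1 0 1 := by simp [θ, coe_flipSL, flipMatrix]
    rw [LinearMap.comp_apply, LinearMap.comp_apply, twistedRestriction_apply,
      twistedRestriction_apply, e01, map_smul, map_smul, map_smul, map_smul]
    congr 1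
    have merge : ∀ a b c : U11 σ, π a (π b (π c u)) = π (a * (b * c)) u := fun a b c => by
      rw [map_mul, map_mul, Module.End.mul_apply, Module.End.mul_apply]
    rw [kappaTwist_apply, kappaTwist_apply, merge, merge]
    refine invariantsProj_flip_eq hσ rfl hfin' hu ?_
    rw [Subgroup.coe_mul, Subgroup.coe_mul, Subgroup.coe_mul, Subgroup.coe_mul, ← mul_assoc,
      alphaKappa_mul_kappaConj_inv, mul_assoc, ← mul_assoc (alphaKappa E κ),
      alphaKappa_mul_kappaConj_inv]
    simp only [Units.val_mul, mul_assoc, flipMatrix_mul] at hh' ⊢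
    rw [hh', coe_flipU11, coe_slToU11, coe_slToU11, flipMatrix_map]
    rfl
  have step2 := invariantsProj_flip_eq hσ rfl hfin' hu hh'
  -- Undoing the flip of g happens inside π' alone, hence κ = 1.
  have step3 := invariantsProj_flip_eq (κ := 1) (π := kappaTwist σ κ⁻¹ π) hσ
    (by rw [inv_one, kappaTwist_one]) hfin' (u := invariantsProj hfin' (π h u))
    (fun k => apply_invariantsProj hfin' k _) (x := g) (x' := flipU11 g) (by
      rw [alphaKappa_one, one_mul, one_mul, coe_flipU11])
  rw [step1, ← step2, step3]

theorem nonempty_equiv_of_fixed_ne_zero [Algebra.IsQuadraticExtension F E]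
    (hσ : σ ≠ AlgEquiv.refl) (hπ' : π' = kappaTwist σ κ⁻¹ π) (hirr : π.IsIrreducible)
    (hfin : HasFiniteOrbits (twistedRestriction hψ hδ π))
    (hfin' : HasFiniteOrbits (twistedRestriction hψ hδ π')) {u u' : V}
    (hu : ∀ k, twistedRestriction hψ hδ π k u = u) (hu0 : u ≠ 0)
    (hu' : ∀ k, twistedRestriction hψ hδ π' k u' = u') (hu0' : u' ≠ 0) :
    Nonempty (π.Equiv π') := by
  -- Otherwise e' kills the span of the orbit of u, which is all of V and contains u'.
  obtain ⟨h, hh⟩ : ∃ h, invariantsProj hfin' (π h u) ≠ 0 := by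
    by_contra! hall
    apply hu0'
    obtain ⟨f, hf⟩ := orbitMap_surjective hirr hu0 u'
    rw [← invariantsProj_of_fixed hfin' hu', ← hf]
    clear hf
    induction f using Finsupp.induction_linear with
    | zero => simp
    | add f f' hf hf' => rw [map_add, map_add, hf, hf', add_zero]
    | single a b => simp [orbitMap_single, hall]
  have hirr' : π'.IsIrreducible := hπ' ▸ isIrreducible_kappaTwist hirr κ⁻¹
  refine Representation.nonempty_equiv_of_matrixCoeff hirr hirr'
    (A := (invariantsProj hfin').comp ((π h).comp (invariantsProj hfin)))
    (B := invariantsProj hfin') (v := u) (w := invariantsProj hfin' (π h u))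
    (fun g => invariantsProj_commute hσ hπ' hfin hfin' hu h g) ?_
  rwa [invariantsProj_of_fixed hfin' fun k => apply_invariantsProj hfin' k _]

end TwistedRestriction

/-! ### From Whittaker functionals to eigenvectors. -/

section WhittakerFunctionals

variable {F E V : Type*} [Field F] [Field E] [Algebra F E] [AddCommGroup V] [Module ℂ V]
  {σ : E ≃ₐ[F] E} {π : Representation ℂ (U11 σ) V}

theorem kappaConj_unipotent (σ : E ≃ₐ[F] E) (κ : Fˣ) (x : F) :
    kappaConj σ κ (unipotent σ x) = unipotent σ (κ * x) := by
  apply Subtype.ext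
  rw [coe_kappaConj, mul_inv_eq_iff_eq_mul]
  apply Units.ext
  ext i j
  fin_cases i <;> fin_cases j <;>
    simp [alphaKappa, unipotent, Matrix.mul_apply, Fin.sum_univ_two]

theorem whittakerFunctionals_kappaTwist {ψ : AddChar F Circle} {l : Module.Dual ℂ V}
    (hl : l ∈ whittakerFunctionals σ π ψ) (κ : Fˣ) :
    l ∈ whittakerFunctionals σ (kappaTwist σ κ π) (ψ.mulShift κ.1) := by
  intro x w
  rw [kappaTwist_apply, kappaConj_unipotent, hl, AddChar.mulShift_apply]

variable [ValuativeRel F]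

open ValuativeRel in
-- Factor k = n a with n upper unipotent and a lower triangular. Then a fixes w and l turns n into
-- ψ(k₀₁/k₁₁) = ψ(k₀₁), so l is constant on the twisted orbit and takes the value l w on the
-- projection.
theorem invariantsProj_twistedRestriction_ne_zero {ψ : AddChar F Circle} {δ : F}
    {hψ : HasConductor (valuation F) ψ δ} {hδ : valuation F δ < 1}
    (hfin : HasFiniteOrbits (twistedRestriction hψ hδ π))
    {l : Module.Dual ℂ V} (hl : l ∈ whittakerFunctionals σ π ψ) {w : V} (hlw : l w ≠ 0)
    (hw : ∀ g ∈ gammaOne (valuation F) δ hδ, g.1 0 1 = 0 → π (slToU11 σ g) w = w) :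
    invariantsProj hfin w ≠ 0 := by
  intro h0
  apply hlw
  rw [← map_invariantsProj_eq_of_forall hfin (L := l) (v := w) (w := l w), h0, map_zero]
  intro k
  obtain ⟨h1, h2, h3, h4⟩ := mem_gammaOne.1 k.2
  have hd : valuation F (k.1.1 1 1) = 1 := by
    have := Valuation.map_one_add_of_lt (v := valuation F) (h4.trans_lt hδ)
    simpa using this
  have hd0 : k.1.1 1 1 ≠ 0 := fun h => by simp [h] at hd
  have hdet : k.1.1 0 0 * k.1.1 1 1 - k.1.1 0 1 * k.1.1 1 0 = 1 := by
    rw [← Matrix.det_fin_two]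
    exact k.1.2
  let a : SpecialLinearGroup (Fin 2) F :=
    ⟨!![(k.1.1 1 1)⁻¹, 0; k.1.1 1 0, k.1.1 1 1], by simp [Matrix.det_fin_two, hd0]⟩
  let n : SpecialLinearGroup (Fin 2) F :=
    ⟨!![1, k.1.1 0 1 / k.1.1 1 1; 0, 1], by simp [Matrix.det_fin_two]⟩
  have hkn : k.1 = n * a := by
    apply Subtype.ext
    rw [Matrix.SpecialLinearGroup.coe_mul]
    ext i j
    fin_cases i <;> fin_cases j <;> simp [n, a, Matrix.mul_apply, Fin.sum_univ_two] <;> field_simp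
    linear_combination hdet
  have ha : a ∈ gammaOne (valuation F) δ hδ := by
    refine mk_mem_gammaOne _ ?_ (by simp) h3 h4
    have e : (k.1.1 1 1)⁻¹ - 1 = -(k.1.1 1 1 - 1) / k.1.1 1 1 := by field_simp; ring
    rw [e, map_div₀, hd, div_one, Valuation.map_neg]
    exact h4
  have hn : slToU11 σ n = unipotent σ (k.1.1 0 1 / k.1.1 1 1) := slToU11_upper σ _ _
  have hψn : ψ (k.1.1 0 1 / k.1.1 1 1) = ψ (k.1.1 0 1) := by
    apply hψ.eq_of_le
    have e : k.1.1 0 1 / k.1.1 1 1 - k.1.1 0 1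
        = - (k.1.1 0 1 * (k.1.1 1 1 - 1)) / k.1.1 1 1 := by field_simp; ring
    rw [e, map_div₀, hd, div_one, Valuation.map_neg, map_mul]
    exact mul_le_of_le_one_of_le h2 h4
  have hsl : slToU11 σ k.1 = unipotent σ (k.1.1 0 1 / k.1.1 1 1) * slToU11 σ a :=
    (congrArg (slToU11 σ) hkn).trans ((map_mul _ _ _).trans (congrArg (· * slToU11 σ a) hn))
  rw [twistedRestriction_apply, map_smul, hsl, map_mul, Module.End.mul_apply,
    hw a ha (by simp [a]), hl, hψn, smul_eq_mul, ← mul_assoc, Circle.coe_inv,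
    inv_mul_cancel₀ (Circle.coe_ne_zero _), one_mul]

end WhittakerFunctionals

/-! ### Rescaling the conductor. -/

section Conductor

variable {F : Type*} [Field F]

theorem HasConductor.mulShift {Γ₀ : Type*} [LinearOrderedCommGroupWithZero Γ₀] {v : Valuation F Γ₀}
    {ψ : AddChar F Circle} {δ : F} (h : HasConductor v ψ δ) (t : Fˣ) :
    HasConductor v (ψ.mulShift t⁻¹.1) (t.1 * δ) where
  ne_zero := mul_ne_zero t.ne_zero h.ne_zero
  eq_one x hx := by
    rw [AddChar.mulShift_apply]
    apply h.eq_one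
    rw [map_mul, Units.val_inv_eq_inv_val, map_inv₀,
      inv_mul_le_iff₀ (zero_lt_iff.2 ((Valuation.ne_zero_iff v).2 t.ne_zero)), ← map_mul]
    exact hx
  exists_ne_one x hx := by
    obtain ⟨y, hy, hne⟩ := h.exists_ne_one (t⁻¹.1 * x) (by
      rw [map_mul, Units.val_inv_eq_inv_val, map_inv₀,
        lt_inv_mul_iff₀ (zero_lt_iff.2 ((Valuation.ne_zero_iff v).2 t.ne_zero)), ← map_mul]
      exact hx)
    exact ⟨y, hy, by rwa [AddChar.mulShift_apply, ← mul_assoc]⟩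

end Conductor

/-! ### Conductors of characters and the topology of SL₂ of a local field. -/

section CharactersOfLocalFields

open ValuativeRel

/-- The circle has no small subgroups: squaring w multiplies its distance to 1 by |w + 1|, which is
at least 3/2 while w stays within 1/2 of 1. -/
theorem Circle.eq_one_of_forall_pow_dist_le {z : Circle} (hz : ∀ n : ℕ, ‖(z : ℂ) ^ n - 1‖ ≤ 1 / 2) :
    z = 1 := by
  by_contra hne
  have h0 : 0 < ‖(z : ℂ) - 1‖ := by
    rw [norm_pos_iff, sub_ne_zero]
    exact fun h => hne (Circle.ext h)
  have step : ∀ n : ℕ, (3 / 2 : ℝ) ^ n * ‖(z : ℂ) - 1‖ ≤ ‖(z : ℂ) ^ 2 ^ n - 1‖ := by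
    intro n
    induction n with
    | zero => simp
    | succ n ih =>
      set w := (z : ℂ) ^ 2 ^ n with hw
      have e : (z : ℂ) ^ 2 ^ (n + 1) - 1 = (w - 1) * (w + 1) := by rw [hw]; ring
      have h2 : (3 / 2 : ℝ) ≤ ‖w + 1‖ := by
        have h3 : ‖(2 : ℂ)‖ ≤ ‖w + 1‖ + ‖w - 1‖ := by
          have : (2 : ℂ) = (w + 1) - (w - 1) := by ring
          rw [this]
          exact norm_sub_le _ _
        have h4 := hz (2 ^ n)
        rw [Complex.norm_ofNat] at h3
        linarith
      rw [e, norm_mul, pow_succ]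
      have := norm_nonneg (w - 1)
      nlinarith
  obtain ⟨n, hn⟩ := pow_unbounded_of_one_lt (1 / 2 / ‖(z : ℂ) - 1‖) (by norm_num : (1 : ℝ) < 3 / 2)
  rw [div_lt_iff₀ h0] at hn
  exact absurd (hn.trans_le ((step n).trans (hz _))) (lt_irrefl _)

variable {F : Type*} [Field F] [ValuativeRel F] [TopologicalSpace F] [IsNonarchimedeanLocalField F]

theorem AddChar.exists_valuation_lt_eq_one {ψ : AddChar F Circle} (hψ : Continuous ψ) :
    ∃ γ : ValueGroupWithZero F, γ ≠ 0 ∧ ∀ x, valuation F x < γ → ψ x = 1 := by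
  have hc : Continuous fun x => ‖((ψ x : Circle) : ℂ) - 1‖ := by fun_prop
  have hmem : {x | ‖((ψ x : Circle) : ℂ) - 1‖ < 1 / 2} ∈ nhds (0 : F) :=
    (isOpen_lt hc continuous_const).mem_nhds (by simp)
  obtain ⟨γ, hγ, hsub⟩ := (IsValuativeTopology.hasBasis_nhds_zero' F).mem_iff.1 hmem
  refine ⟨γ, hγ, fun x hx => Circle.eq_one_of_forall_pow_dist_le fun n => ?_⟩
  have hn : valuation F (n • x) < γ := by
    induction n with
    | zero => simpa [zero_lt_iff] using hγ
    | succ n ih => rw [succ_nsmul]; exact Valuation.map_add_lt _ ih hx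
  have := le_of_lt (show ‖((ψ (n • x) : Circle) : ℂ) - 1‖ < 1 / 2 from hsub hn)
  rwa [AddChar.map_nsmul_eq_pow, Circle.coe_pow] at this

theorem exists_unit_valuation_lt {γ : ValueGroupWithZero F} (hγ : γ ≠ 0) :
    ∃ t : Fˣ, valuation F t.1 < γ := by
  obtain ⟨c, rfl⟩ := valuation_surjective γ
  obtain ⟨ϖ, h0, h1⟩ := Valuation.IsNontrivial.exists_lt_one (v := valuation F)
  refine ⟨Units.mk0 (ϖ * c) (mul_ne_zero (by simpa using h0) (by simpa using hγ)), ?_⟩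
  rw [Units.val_mk0, map_mul]
  exact mul_lt_of_lt_one_left (zero_lt_iff.2 hγ) h1

theorem HasConductor.exists_of_continuous {ψ : AddChar F Circle} (hψ : Continuous ψ) (hne : ψ ≠ 1) :
    ∃ δ, HasConductor (valuation F) ψ δ := by
  obtain ⟨γ, hγ, hsmall⟩ := AddChar.exists_valuation_lt_eq_one hψ
  obtain ⟨z, hz⟩ := AddChar.ne_one_iff.1 hne
  have hz0 : z ≠ 0 := fun h => hz (by rw [h, AddChar.map_zero_eq_one])
  have hvz : valuation F z ≠ 0 := by simpa using hz0
  -- Dividing by z, where ψ(z) ≠ 1, moves the largest fractional ideal in the kernel of ψ into the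
  -- integers, where it is principal. Its generator is nonzero because ψ is trivial near 0.
  let I : Ideal 𝒪[F] :=
    { carrier := {a | ∀ y, valuation F y ≤ 1 → ψ (a.1 * z * y) = 1}
      add_mem' := fun {a b} ha hb y hy => by
        rw [Subring.coe_add, add_mul, add_mul, AddChar.map_add_eq_mul, ha y hy, hb y hy, one_mul]
      zero_mem' := fun y _ => by simp
      smul_mem' := fun c a ha y hy => by
        have e : (c • a).1 * z * y = a.1 * z * (c.1 * y) := by
          rw [smul_eq_mul, Subring.coe_mul]; ring
        rw [e]
        refine ha _ ?_
        rw [map_mul]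
        exact mul_le_one' c.2 hy }
  have hI : ∀ a : 𝒪[F], a ∈ I ↔ ∀ y, valuation F y ≤ 1 → ψ (a.1 * z * y) = 1 := fun a => Iff.rfl
  have hlt : ∀ x, (∀ y, valuation F y ≤ 1 → ψ (x * y) = 1) → valuation F x < valuation F z := by
    intro x hx
    by_contra! hle
    have hx0 : x ≠ 0 := by
      rintro rfl
      rw [map_zero, le_zero_iff] at hle
      exact hvz hle
    apply hz
    have := hx (z / x) (by rw [map_div₀]; exact div_le_one_of_le₀ hle zero_le)
    rwa [mul_div_cancel₀ _ hx0] at this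
  have hmem : ∀ x, (∀ y, valuation F y ≤ 1 → ψ (x * y) = 1) →
      ∃ a : 𝒪[F], a ∈ I ∧ x = a.1 * z := by
    intro x hx
    have hxz : valuation F (x / z) ≤ 1 := by
      rw [map_div₀]; exact div_le_one_of_le₀ (hlt x hx).le zero_le
    refine ⟨⟨x / z, hxz⟩, ?_, ?_⟩
    · rw [hI]
      simpa [div_mul_cancel₀ _ hz0] using hx
    · exact (div_mul_cancel₀ _ hz0).symm
  obtain ⟨g, hg⟩ := (IsPrincipalIdealRing.principal I).principal
  have hgI : g ∈ I := by rw [hg]; exact Submodule.mem_span_singleton_self g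
  refine ⟨g.1 * z, ?_, ?_, ?_⟩
  · obtain ⟨s, hs⟩ := exists_unit_valuation_lt hγ
    obtain ⟨a, ha, hsa⟩ := hmem s fun y hy => hsmall _ (by
      rw [map_mul]; exact (mul_le_of_le_of_le_one le_rfl hy).trans_lt hs)
    rw [hg, Submodule.mem_span_singleton] at ha
    obtain ⟨c, rfl⟩ := ha
    intro h0
    apply s.ne_zero
    rw [hsa, smul_eq_mul, Subring.coe_mul, mul_assoc, h0, mul_zero]
  · intro x hx
    rcases eq_or_ne (g.1 * z) 0 with h0 | h0
    · rw [h0, map_zero, le_zero_iff, map_eq_zero] at hx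
      rw [hx, AddChar.map_zero_eq_one]
    · have := hgI (x / (g.1 * z)) (by rw [map_div₀]; exact div_le_one_of_le₀ hx zero_le)
      rwa [mul_div_cancel₀ _ h0] at this
  · intro x hx
    by_contra! hall
    obtain ⟨a, ha, rfl⟩ := hmem x hall
    rw [hg, Submodule.mem_span_singleton] at ha
    obtain ⟨c, rfl⟩ := ha
    refine hx.not_ge ?_
    rw [smul_eq_mul, Subring.coe_mul, mul_assoc, map_mul]
    exact mul_le_of_le_one_of_le c.2 le_rfl

theorem t1Space_of_isNonarchimedeanLocalField : T1Space F := by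
  refine ⟨fun x => ?_⟩
  rw [← isOpen_compl_iff, isOpen_iff_mem_nhds]
  intro y hy
  rw [(IsValuativeTopology.hasBasis_nhds' y).mem_iff]
  refine ⟨valuation F (x - y), by simpa [sub_eq_zero] using Ne.symm hy, fun w hw => ?_⟩
  rintro rfl
  exact lt_irrefl (valuation F (w - y)) hw

theorem setOf_valuation_le_mem_nhds {γ : ValueGroupWithZero F} (hγ : γ ≠ 0) :
    {x | valuation F x ≤ γ} ∈ nhds (0 : F) :=
  (IsValuativeTopology.hasBasis_nhds_zero' F).mem_iff.2 ⟨γ, hγ, fun x hx =>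
    show valuation F x ≤ γ from le_of_lt (show valuation F x < γ from hx)⟩

theorem isClosedEmbedding_specialLinearGroup_val :
    Topology.IsClosedEmbedding
      (fun g : SpecialLinearGroup (Fin 2) F => (g.1 : Matrix (Fin 2) (Fin 2) F)) :=
  have : T1Space F := t1Space_of_isNonarchimedeanLocalField
  Matrix.SpecialLinearGroup.isClosedEmbedding_val

theorem compactSpace_gammaOne {δ : F} (hδ : valuation F δ < 1) :
    CompactSpace (gammaOne (valuation F) δ hδ) := by
  let γ : Fin 2 → Fin 2 → ValueGroupWithZero F :=
    !![valuation F δ, 1; valuation F δ, valuation F δ]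
  let B : Fin 2 → Fin 2 → Set F := fun i j =>
    (fun x => x + (1 : Matrix (Fin 2) (Fin 2) F) i j) '' {x | valuation F x ≤ γ i j}
  have hB : ∀ i j, IsCompact (B i j) := fun i j =>
    (IsNonarchimedeanLocalField.isCompact_closedBall F _).image (by fun_prop)
  have hC : IsCompact (Set.pi Set.univ fun i => Set.pi Set.univ fun j => B i j) :=
    isCompact_univ_pi fun i => isCompact_univ_pi fun j => hB i j
  have hmemB : ∀ i j x, x ∈ B i j ↔
      valuation F (x - (1 : Matrix (Fin 2) (Fin 2) F) i j) ≤ γ i j := by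
    intro i j x
    constructor
    · rintro ⟨y, hy, rfl⟩
      simpa using hy
    · intro hx
      exact ⟨_, hx, sub_add_cancel _ _⟩
  suffices h : IsCompact (gammaOne (valuation F) δ hδ : Set (SpecialLinearGroup (Fin 2) F)) from
    isCompact_iff_compactSpace.1 h
  convert isClosedEmbedding_specialLinearGroup_val.isCompact_preimage hC using 1
  ext g
  rw [SetLike.mem_coe, mem_gammaOne]
  change _ ↔ ∀ i, i ∈ Set.univ → ∀ j, j ∈ Set.univ → g.1 i j ∈ B i j
  simp only [Set.mem_univ, true_imp_iff, hmemB, Fin.forall_fin_two, γ]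
  simp
  tauto

/-- Elements of `SL₂` whose entries are close to those of the identity are close to it. -/
theorem exists_valuation_lt_of_mem_nhds_one {s : Set (SpecialLinearGroup (Fin 2) F)}
    (hs : s ∈ nhds 1) : ∃ γ : ValueGroupWithZero F, γ ≠ 0 ∧ ∀ g : SpecialLinearGroup (Fin 2) F,
      (∀ i j, valuation F (g.1 i j - (1 : Matrix (Fin 2) (Fin 2) F) i j) < γ) → g ∈ s := by
  rw [isClosedEmbedding_specialLinearGroup_val.isInducing.nhds_eq_comap] at hs
  obtain ⟨t, ht, hts⟩ := hs
  have ht' : (t : Set (Fin 2 → Fin 2 → F)) ∈ Filter.pi fun i =>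
      nhds ((1 : Matrix (Fin 2) (Fin 2) F) i) :=
    (nhds_pi (a := (1 : Matrix (Fin 2) (Fin 2) F))).ge ht
  obtain ⟨_, u, hu, hut⟩ := Filter.mem_pi'.1 ht'
  have hu' : ∀ i, ∃ w : Fin 2 → Set F, (∀ j, w j ∈ nhds ((1 : Matrix (Fin 2) (Fin 2) F) i j)) ∧
      Set.pi Set.univ w ⊆ u i := by
    intro i
    have h := hu i
    rw [nhds_pi, Filter.mem_pi'] at h
    obtain ⟨I, w, hw, hwu⟩ := h
    exact ⟨w, hw, fun x hx => hwu fun j _ => hx j trivial⟩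
  choose w hw hwu using hu'
  have hγ : ∀ i j, ∃ γ : ValueGroupWithZero F, γ ≠ 0 ∧
      {y | valuation F (y - (1 : Matrix (Fin 2) (Fin 2) F) i j) < γ} ⊆ w i j := fun i j =>
    (IsValuativeTopology.hasBasis_nhds' _).mem_iff.1 (hw i j)
  choose γ hγ0 hγw using hγ
  refine ⟨min (min (γ 0 0) (γ 0 1)) (min (γ 1 0) (γ 1 1)), ?_, fun g hg => hts (hut ?_)⟩
  · simp only [← zero_lt_iff, lt_min_iff] at hγ0 ⊢
    exact ⟨⟨hγ0 0 0, hγ0 0 1⟩, ⟨hγ0 1 0, hγ0 1 1⟩⟩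
  · intro i _
    apply hwu
    intro j _
    apply hγw
    refine (hg i j).trans_le ?_
    fin_cases i <;> fin_cases j <;> simp

end CharactersOfLocalFields

/-! ### Smoothness under restriction and twisting. -/

section Whittaker

open ValuativeRel

variable {F E V : Type*} [Field F] [ValuativeRel F] [TopologicalSpace F]
  [IsNonarchimedeanLocalField F] [Field E] [Algebra F E] [Algebra.IsQuadraticExtension F E]
  [TopologicalSpace E] [IsModuleTopology F E] [AddCommGroup V] [Module ℂ V]
  {σ : E ≃ₐ[F] E} {π : Representation ℂ (U11 σ) V}

theorem continuous_slToU11 (σ : E ≃ₐ[F] E) : Continuous (slToU11 σ) := by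
  have : IsTopologicalRing E := IsModuleTopology.isTopologicalRing F E
  have hcont : Continuous (algebraMap F E) := continuous_algebraMap F E
  refine Continuous.subtype_mk ?_ _
  exact Matrix.SpecialLinearGroup.continuous_toGL.comp hcont.specialLinearGroup_map

theorem isSmoothRep_kappaTwist (hπ : IsSmoothRep π) (κ : Fˣ) : IsSmoothRep (kappaTwist σ κ π) := by
  have : IsTopologicalRing E := IsModuleTopology.isTopologicalRing F E
  intro w
  have hcont : Continuous (kappaConj σ κ) := by
    refine Continuous.subtype_mk ?_ _
    fun_prop
  exact (hπ w).preimage hcont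

/-- Near 1 both ψ(k₀₁) and the action on w are trivial, so stabilizers are open in a compact group.
-/
theorem hasFiniteOrbits_twistedRestriction (hπ : IsSmoothRep π) {ψ : AddChar F Circle} {δ : F}
    (hψ : HasConductor (valuation F) ψ δ) (hδ : valuation F δ < 1) :
    HasFiniteOrbits (twistedRestriction hψ hδ π) := by
  intro w
  have := compactSpace_gammaOne hδ
  have hopen : IsOpen (vectorStabilizer (twistedRestriction hψ hδ π) w :
      Set (gammaOne (valuation F) δ hδ)) := by
    refine Subgroup.isOpen_of_mem_nhds _ (g := 1) ?_
    have h1 : {k : gammaOne (valuation F) δ hδ | π (slToU11 σ k) w = w} ∈ nhds 1 := by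
      refine IsOpen.mem_nhds ?_ (by simp)
      exact (hπ w).preimage ((continuous_slToU11 σ).comp continuous_subtype_val)
    have h2 : {k : gammaOne (valuation F) δ hδ | valuation F (k.1.1 0 1) ≤ valuation F δ}
        ∈ nhds 1 := by
      have hc : Continuous fun k : gammaOne (valuation F) δ hδ => k.1.1 0 1 :=
        (continuous_apply_apply (0 : Fin 2) (1 : Fin 2)).comp
          (isClosedEmbedding_specialLinearGroup_val.continuous.comp continuous_subtype_val)
      refine hc.continuousAt.preimage_mem_nhds (t := {x | valuation F x ≤ valuation F δ}) ?_
      have e : (1 : gammaOne (valuation F) δ hδ).1.1 0 1 = 0 := by simp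
      rw [e]
      exact setOf_valuation_le_mem_nhds (by simpa using hψ.ne_zero)
    filter_upwards [h1, h2] with k hk1 hk2
    rw [SetLike.mem_coe, mem_vectorStabilizer, twistedRestriction_apply, hψ.eq_one _ hk2, hk1]
    simp
  have := Subgroup.quotient_finite_of_isOpen _ hopen
  exact Subgroup.finiteIndex_of_finite_quotient

/-- A smooth vector is fixed by the lower triangular elements of a congruence subgroup, after a
twist by a sufficiently large element of the torus. -/
theorem exists_forall_lower_fixed (hπ : IsSmoothRep π) (δ₀ : F) (w : V) :
    ∃ γ : ValueGroupWithZero F, γ ≠ 0 ∧ ∀ t : Fˣ, valuation F t.1 < γ →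
      ∀ hδ : valuation F (t.1 * δ₀) < 1, ∀ g ∈ gammaOne (valuation F) (t.1 * δ₀) hδ,
        g.1 0 1 = 0 → kappaTwist σ t⁻¹ π (slToU11 σ g) w = w := by
  have hmem : {g : SpecialLinearGroup (Fin 2) F | π (slToU11 σ g) w = w} ∈ nhds 1 :=
    IsOpen.mem_nhds ((hπ w).preimage (continuous_slToU11 σ)) (by simp)
  obtain ⟨γ, hγ, hγw⟩ := exists_valuation_lt_of_mem_nhds_one hmem
  -- The bound β ≤ 1 controls the entry tc, and βv(δ₀) ≤ γ controls tδ₀.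
  obtain ⟨β, hβ, hβ1, hβ2⟩ : ∃ β : ValueGroupWithZero F, β ≠ 0 ∧ β ≤ 1 ∧
      β * valuation F δ₀ ≤ γ := by
    rcases eq_or_ne (valuation F δ₀) 0 with h | h
    · exact ⟨1, one_ne_zero, le_rfl, by rw [h]; simp⟩
    · refine ⟨min 1 (γ / valuation F δ₀), ?_, min_le_left _ _, ?_⟩
      · rw [← zero_lt_iff, lt_min_iff]
        exact ⟨zero_lt_one, div_pos (zero_lt_iff.2 hγ) (zero_lt_iff.2 h)⟩
      · rw [← le_div_iff₀ (zero_lt_iff.2 h)]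
        exact min_le_right _ _
  refine ⟨β, hβ, fun t ht hδ g hg h01 => ?_⟩
  have hlt : valuation F (t.1 * δ₀) < γ := by
    rw [map_mul]
    rcases eq_or_ne (valuation F δ₀) 0 with h | h
    · rw [h, mul_zero]; exact zero_lt_iff.2 hγ
    · exact (mul_lt_mul_of_pos_right ht (zero_lt_iff.2 h)).trans_le hβ2
  obtain ⟨h1, -, h3, h4⟩ := mem_gammaOne.1 hg
  have hdet : g.1 0 0 * g.1 1 1 = 1 := by
    have := g.2
    rwa [Matrix.det_fin_two, h01, zero_mul, sub_zero] at this
  let g' : SpecialLinearGroup (Fin 2) F :=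
    ⟨!![g.1 0 0, 0; t.1 * g.1 1 0, g.1 1 1], by simp [Matrix.det_fin_two, hdet]⟩
  have e : kappaConj σ t⁻¹ (slToU11 σ g) = slToU11 σ g' := by
    apply Subtype.ext
    apply mul_left_cancel (a := alphaKappa E t)
    rw [alphaKappa_mul_kappaConj_inv]
    apply Units.ext
    rw [Units.val_mul, Units.val_mul, coe_slToU11, coe_slToU11, coe_alphaKappa, ← Matrix.map_mul,
      ← Matrix.map_mul]
    congr 1
    ext i j
    fin_cases i <;> fin_cases j <;> simp [g', Matrix.mul_apply, Fin.sum_univ_two, h01, mul_comm]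
  rw [kappaTwist_apply, e]
  refine hγw g' fun i j => ?_
  fin_cases i <;> fin_cases j
  · simpa [g'] using h1.trans_lt hlt
  · simpa [g', zero_lt_iff] using hγ
  · have : valuation F (t.1 * g.1 1 0) < γ := by
      rw [map_mul]
      exact (mul_le_of_le_one_of_le (ht.le.trans hβ1) h3).trans_lt hlt
    simpa [g'] using this
  · simpa [g'] using h4.trans_lt hlt

end Whittaker

/-! ### Transport of Whittaker models along π ≅ π^κ. -/

section KappaTwist

variable {F E V : Type*} [Field F] [Field E] [Algebra F E] [AddCommGroup V] [Module ℂ V]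
  {σ : E ≃ₐ[F] E} {π : Representation ℂ (U11 σ) V} {ψ : AddChar F Circle} {κ : Fˣ}

theorem nonempty_equiv_kappaTwist {ρ : Representation ℂ (U11 σ) V} (e : π.Equiv ρ) (c : Fˣ) :
    Nonempty ((kappaTwist σ c π).Equiv (kappaTwist σ c ρ)) :=
  ⟨.mk e.toLinearEquiv fun g => e.isIntertwining' (kappaConj σ c g)⟩

theorem exists_whittakerFunctional_ne_zero (hW : whittakerSpace σ π ψ ≠ ⊥) :
    ∃ l ∈ whittakerFunctionals σ π ψ, ∃ w, l w ≠ 0 := by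
  by_contra! hall
  apply hW
  rw [whittakerSpace, Submodule.span_eq_bot]
  rintro _ ⟨l, hl, w, rfl⟩
  ext h
  exact hall l hl _

theorem comp_mem_whittakerFunctionals (Φ : π.Equiv (kappaTwist σ κ π)) {l : Module.Dual ℂ V}
    (hl : l ∈ whittakerFunctionals σ π ψ) :
    l ∘ₗ Φ.toLinearEquiv.toLinearMap ∈ whittakerFunctionals σ π (ψ.mulShift κ.1) := by
  intro x w
  have h := LinearMap.congr_fun (Φ.isIntertwining' (unipotent σ x)) w
  have h' := whittakerFunctionals_kappaTwist hl κ x (Φ w)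
  exact (congrArg l h).trans h'

theorem comp_symm_mem_whittakerFunctionals (Φ : π.Equiv (kappaTwist σ κ π)) {l : Module.Dual ℂ V}
    (hl : l ∈ whittakerFunctionals σ π (ψ.mulShift κ.1)) :
    l ∘ₗ Φ.symm.toLinearEquiv.toLinearMap ∈ whittakerFunctionals σ π ψ := by
  intro x w
  have e : unipotent σ x = kappaConj σ κ (unipotent σ (κ⁻¹.1 * x)) := by
    rw [kappaConj_unipotent, Units.mul_inv_cancel_left]
  have h := LinearMap.congr_fun (Φ.symm.isIntertwining' (unipotent σ (κ⁻¹.1 * x))) w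
  have h' := hl (κ⁻¹.1 * x) (Φ.symm w)
  rw [AddChar.mulShift_apply, Units.mul_inv_cancel_left] at h'
  rw [e, ← kappaTwist_apply]
  exact (congrArg l h).trans h'

/-- If `π ≅ π^κ`, then `W ↦ W^κ` identifies the two Whittaker models of `π`. -/
theorem bijOn_whittakerSpace (Φ : π.Equiv (kappaTwist σ κ π)) :
    Set.BijOn (fun (W : U11 σ → ℂ) (h : U11 σ) => W (kappaConj σ κ h))
      (whittakerSpace σ π ψ : Set (U11 σ → ℂ))
      (whittakerSpace σ π (ψ.mulShift (κ : F)) : Set (U11 σ → ℂ)) := by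
  let T : (U11 σ → ℂ) →ₗ[ℂ] (U11 σ → ℂ) := LinearMap.funLeft ℂ ℂ (kappaConj σ κ)
  have hT : Submodule.map T (whittakerSpace σ π ψ) = whittakerSpace σ π (ψ.mulShift (κ : F)) := by
    rw [whittakerSpace, Submodule.map_span, whittakerSpace]
    congr 1
    ext W
    constructor
    · rintro ⟨_, ⟨l, hl, w, rfl⟩, rfl⟩
      refine ⟨_, comp_mem_whittakerFunctionals Φ hl, Φ.symm w, ?_⟩
      ext h
      have h1 := LinearMap.congr_fun (Φ.isIntertwining' h) (Φ.symm w)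
      refine congrArg l (Eq.trans ?_ h1.symm)
      exact congrArg (π (kappaConj σ κ h)) (Φ.apply_symm_apply w).symm
    · rintro ⟨l, hl, w, rfl⟩
      refine ⟨_, ⟨_, comp_symm_mem_whittakerFunctionals Φ hl, Φ w, rfl⟩, ?_⟩
      ext h
      have h1 := LinearMap.congr_fun (Φ.symm.isIntertwining' h) (Φ w)
      refine congrArg l (h1.trans ?_)
      exact congrArg (π h) (Φ.symm_apply_apply w)
  refine ⟨fun W hW => ?_, fun W _ W' _ h => ?_, fun W hW => ?_⟩
  · exact hT.le (Submodule.mem_map_of_mem (f := T) hW)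
  · exact LinearMap.funLeft_injective_of_surjective ℂ ℂ _ (kappaConj_surjective σ κ) h
  · exact hT.ge hW

end KappaTwist

/-! ### Representations generic for both characters. -/

section MultiplicityOne

open ValuativeRel

variable {F E V : Type*} [Field F] [ValuativeRel F] [TopologicalSpace F]
  [IsNonarchimedeanLocalField F] [Field E] [Algebra F E] [Algebra.IsQuadraticExtension F E]
  [TopologicalSpace E] [IsModuleTopology F E] [AddCommGroup V] [Module ℂ V]
  {σ : E ≃ₐ[F] E} {π : Representation ℂ (U11 σ) V}

/-- An irreducible smooth representation that is generic for `ψ` and for `ψ_κ` is isomorphic to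
its twist by `κ`. -/
theorem nonempty_equiv_kappaTwist_of_generic (hσ : σ ≠ AlgEquiv.refl) {ψ : AddChar F Circle}
    (hψ_cont : Continuous ψ) (hψ : ψ ≠ 1) {κ : Fˣ} (hirr : π.IsIrreducible)
    (hsmooth : IsSmoothRep π) (hW : whittakerSpace σ π ψ ≠ ⊥)
    (hWκ : whittakerSpace σ π (ψ.mulShift (κ : F)) ≠ ⊥) :
    Nonempty (π.Equiv (kappaTwist σ κ π)) := by
  obtain ⟨l, hl, w, hlw⟩ := exists_whittakerFunctional_ne_zero hW
  obtain ⟨l', hl', w', hlw'⟩ := exists_whittakerFunctional_ne_zero hWκ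
  obtain ⟨δ₀, hδ₀⟩ := HasConductor.exists_of_continuous hψ_cont hψ
  have hsmooth' := isSmoothRep_kappaTwist hsmooth κ⁻¹
  -- A ψ_κ-functional of π is a ψ-functional of π^{κ⁻¹}, so both representations are tested against
  -- the same ψ.
  replace hl' := whittakerFunctionals_kappaTwist hl' κ⁻¹
  rw [AddChar.mulShift_mulShift, Units.mul_inv, AddChar.mulShift_one] at hl'
  obtain ⟨γ, hγ, hfix⟩ := exists_forall_lower_fixed hsmooth δ₀ w
  obtain ⟨γ', hγ', hfix'⟩ := exists_forall_lower_fixed hsmooth' δ₀ w'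
  have hv0 : 0 < valuation F δ₀ := zero_lt_iff.2 (by simpa using hδ₀.ne_zero)
  -- One t serves both vectors w, w' and brings the conductor tδ₀ of the rescaled character into the
  -- maximal ideal.
  obtain ⟨t, ht⟩ := exists_unit_valuation_lt (γ := min (min γ γ') (valuation F δ₀)⁻¹) (by
    rw [← zero_lt_iff, lt_min_iff, lt_min_iff]
    exact ⟨⟨zero_lt_iff.2 hγ, zero_lt_iff.2 hγ'⟩, inv_pos.2 hv0⟩)
  rw [lt_min_iff, lt_min_iff] at ht
  obtain ⟨⟨ht1, ht2⟩, ht3⟩ := ht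
  have hδ : valuation F (t.1 * δ₀) < 1 := by
    rw [map_mul]
    exact (lt_mul_inv_iff₀ hv0).1 (by rwa [one_mul])
  have hψt := hδ₀.mulShift t
  have hfin := hasFiniteOrbits_twistedRestriction (isSmoothRep_kappaTwist hsmooth t⁻¹) hψt hδ
  have hfin' := hasFiniteOrbits_twistedRestriction (isSmoothRep_kappaTwist hsmooth' t⁻¹) hψt hδ
  obtain ⟨e⟩ := nonempty_equiv_of_fixed_ne_zero (κ := κ) hσ
    (by rw [kappaTwist_kappaTwist, kappaTwist_kappaTwist, mul_comm])
    (isIrreducible_kappaTwist hirr t⁻¹) hfin hfin'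
    (fun k => apply_invariantsProj hfin k w)
    (invariantsProj_twistedRestriction_ne_zero hfin (whittakerFunctionals_kappaTwist hl t⁻¹) hlw
      (hfix t ht1 hδ))
    (fun k => apply_invariantsProj hfin' k w')
    (invariantsProj_twistedRestriction_ne_zero hfin' (whittakerFunctionals_kappaTwist hl' t⁻¹) hlw'
      (hfix' t ht2 hδ))
  -- Twisting π^{t⁻¹} ≅ π^{κ⁻¹t⁻¹} by tκ gives π^κ ≅ π.
  obtain ⟨e'⟩ := nonempty_equiv_kappaTwist e (t * κ)
  rw [kappaTwist_kappaTwist, kappaTwist_kappaTwist, kappaTwist_kappaTwist, inv_mul_cancel_left,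
    inv_mul_cancel, kappaTwist_one] at e'
  exact ⟨e'.symm⟩

end MultiplicityOne

theorem mainTheorem4
    {F E V : Type*}
    [Field F] [ValuativeRel F] [TopologicalSpace F] [IsNonarchimedeanLocalField F]
    [Field E] [Algebra F E] [Algebra.IsQuadraticExtension F E]
    [TopologicalSpace E] [IsModuleTopology F E]
    (σ : E ≃ₐ[F] E) (hσ : σ ≠ AlgEquiv.refl)
    (ψ : AddChar F Circle) (hψ_cont : Continuous ψ) (hψ : ψ ≠ 1)
    (κ : Fˣ) (hκ : ∀ a : Eˣ, Algebra.norm F (a : E) ≠ κ)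
    [AddCommGroup V] [Module ℂ V]
    (π : Representation ℂ (U11 σ) V)
    (hirr : π.IsIrreducible) (hsmooth : IsSmoothRep π)
    (hW : whittakerSpace σ π ψ ≠ ⊥)
    (hWκ : whittakerSpace σ π (ψ.mulShift (κ : F)) ≠ ⊥) :
    (IsAdmissibleRep π → Nonempty (π.Equiv (kappaTwist σ κ π))) ∧
    Set.BijOn (fun (W : U11 σ → ℂ) (h : U11 σ) => W (kappaConj σ κ h))
      (whittakerSpace σ π ψ : Set (U11 σ → ℂ))
      (whittakerSpace σ π (ψ.mulShift (κ : F)) : Set (U11 σ → ℂ)) := by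
  obtain ⟨Φ⟩ := nonempty_equiv_kappaTwist_of_generic hσ hψ_cont hψ hirr hsmooth hW hWκ
  exact ⟨fun _ => ⟨Φ⟩, bijOn_whittakerSpace Φ⟩
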